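/- Setting. Let $\mathbb X$ be a Polish space with its Borel $\sigma$-field, $\eta$ a non-atomic probability measure on $\mathbb X$, and $(\rho_x)_{x\in\mathbb X}$ a measurable family of measures on $(0,\infty)$ (an s-finite kernel). Put $\nu(dx,ds)=\eta(dx)\rho_x(ds)$ and assume $\int \min(y,s)\,\nu(dx,dy)<\infty$ for all $s>0$ and $\nu(\mathbb X\times(0,\infty))=\infty$. (These two conditions mean that the total mass below is a.s. finite and a.s. positive.) Let $N$ be a Poisson process on $\mathbb X\times(0,\infty)$ with intensity $\nu$ and let $\tilde\mu(A)=\int_{(0,\infty)} y\,N(A,dy)$ be the corresponding completely random measure. Let $\gamma,q\ge 0$, $h(x)=e^{-\gamma x}x^{-q}$, and assume $E[h(\tilde\mu(\mathbb X))]<\infty$. Let $\tilde\mu_t$ be a random measure with the tilted law $$\mathcal P_{\tilde\mu_t}(A)=\frac1{E[h(\tilde\mu(\mathbb X))]}\int_A h(\mu(\mathbb X))\,\mathcal P_{\tilde\mu}(d\mu).$$ Let $n\ge1$. Given $\tilde\mu_t$, let $\mathbf X_n=(X_1,\dots,X_n)$ be i.i.d. from $\tilde G_t=\tilde\mu_t/\tilde\mu_t(\mathbb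 X)$ and, independently of $\mathbf X_n$, let $U_n$ have the gamma distribution with shape $n+q$ and rate $\tilde\mu_t(\mathbb X)$. Let $\mathbf p_n=\{C_1,\dots,C_{|\mathbf p_n|}\}$ be the random partition of $\{1,\dots,n\}$ in which $i,j$ are in the same cell iff $X_i=X_j$; let $n_k=|C_k|$ and let $Y_k$ be the common value of the $X_i$, $i\in C_k$. Define $$\psi_0(b)=\int_{\mathbb X}\int_0^\infty(1-e^{-bs})\rho_x(ds)\eta(dx),\qquad \tau_{m,z}(a)=\int_0^\infty s^m e^{-sa}\rho_z(ds),\qquad \kappa_m(a)=\int_{\mathbb X}\tau_{m,x}(a)\,\eta(dx).$$ Proposition. For every partition $p$ of $\{1,\dots,n\}$, with cells of sizes $n_1,\dots,n_{|p|}$, put $$I(p)=\int_0^\infty e^{-\psi_0(\gamma+u)}\prod_{k=1}^{|p|}\kappa_{n_k}(\gamma+u)\,u^{n+q-1}\,du .$$ Then $0<I(p)<\infty$ and $0<\prod_{k}\kappa_{n_k}(\gamma+u)<\infty$ for all $u>0$, and the following hold, where all sums run over the partitions $p'$ of $\{1,\dots,n\}$ and $n'_1,n'_2,\dots$ are the cell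 sizes of $p'$. 1. The marginal law of $\mathbf X_n=(\mathbf Y,\mathbf p_n)$: for every partition $p$, $$\mathbb P(\mathbf p_n=p,\ \mathbf Y\in dy)=\frac{\int_0^\infty e^{-\psi_0(\gamma+u)}\prod_{k=1}^{|p|}\tau_{n_k,y_k}(\gamma+u)\,u^{n+q-1}\,du}{\sum_{p'}I(p')}\ \prod_{k=1}^{|p|}\eta(dy_k).$$ 2. The marginal law of $\mathbf p_n$: $\ \mathbb P(\mathbf p_n=p)=I(p)\big/\sum_{p'}I(p')$. 3. Conditionally on $U_n$, $$\mathbb P(\mathbf p_n=p,\ \mathbf Y\in dy\mid U_n)=\frac{\prod_{k=1}^{|p|}\tau_{n_k,y_k}(\gamma+U_n)}{\sum_{p'}\prod_{k=1}^{|p'|}\kappa_{n'_k}(\gamma+U_n)}\ \prod_{k=1}^{|p|}\eta(dy_k)\quad\text{a.s.}$$ 4. Conditionally on $U_n$ the partition has the Gibbs-form law $$\mathbb P(\mathbf p_n=p\mid U_n)=\frac{\prod_{k=1}^{|p|}\kappa_{n_k}(\gamma+U_n)}{\sum_{p'}\prod_{k=1}^{|p'|}\kappa_{n'_k}(\gamma+U_n)}\quad\text{a.s.}$$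 5. Conditionally on $\mathbf p_n=p$, $U_n$ has on $(0,\infty)$ the Lebesgue density $$u\mapsto \frac{e^{-\psi_0(\gamma+u)}\prod_{k=1}^{|p|}\kappa_{n_k}(\gamma+u)\,u^{n+q-1}}{I(p)}.$$ -/

import Mathlib

open MeasureTheory ProbabilityTheory
open scoped ENNReal NNReal

namespace TiltedCRM

/-! ### Poisson processes and completely random measures -/

/-- `N` is a Poisson process (Poisson random measure) on `E` with intensity measure `ν`, on the
probability space `(Ω, P)`: a random measure whose value on every measurable set `B` of finite
intensity is Poisson with mean `ν B`, and whose values on pairwise disjoint measurable sets are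
independent. (For a `σ`-finite `ν` the values on sets of infinite intensity are then a.s. `∞`.) -/
structure IsPoissonProcess {Ω E : Type*} [MeasurableSpace Ω] [MeasurableSpace E]
    (P : Measure Ω) (N : Ω → Measure E) (ν : Measure E) : Prop where
  measurable : Measurable N
  law : ∀ B : Set E, MeasurableSet B → ν B ≠ ∞ →
    P.map (fun ω => N ω B) =
      (poissonMeasure (ν B).toNNReal).map (fun k : ℕ => (k : ℝ≥0∞))
  indep : ∀ (k : ℕ) (B : Fin k → Set E), (∀ i, MeasurableSet (B i)) →
    Pairwise (fun i j => Disjoint (B i) (B j)) → iIndepFun (fun i ω => N ω (B i)) P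

/-- The intensity measure `ν(dx, ds) = η(dx) ρ_x(ds)` on `𝕏 × ℝ`. The jump measures `ρ_x` are
measures on `ℝ` that will be required to be carried by `(0, ∞)`. -/
noncomputable def intensity {𝕏 : Type*} [MeasurableSpace 𝕏]
    (η : Measure 𝕏) (ρ : Kernel 𝕏 ℝ) : Measure (𝕏 × ℝ) :=
  η ⊗ₘ ρ

/-- The measure `A ↦ ∫ y m(A, dy)` on `𝕏` derived from a measure `m` on `𝕏 × ℝ` carried by
`𝕏 × (0, ∞)`. Applied to a Poisson process, it gives the completely random measure `μ̃`. -/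
noncomputable def jumpMeasure {𝕏 : Type*} [MeasurableSpace 𝕏]
    (m : Measure (𝕏 × ℝ)) : Measure 𝕏 :=
  (m.withDensity (fun p => ENNReal.ofReal p.2)).map Prod.fst

/-! ### Tilting -/

/-- The tilting factor `h(x) = e^{-γ x} x^{-q}`. -/
noncomputable def polyExpTilt (γ q x : ℝ) : ℝ :=
  Real.exp (-(γ * x)) * x ^ (-q)

/-- The tilted law: `A ↦ (∫ h(μ(𝕏)) L(dμ))⁻¹ ∫_A h(μ(𝕏)) L(dμ)` for a law `L` of a random
measure. -/
noncomputable def tiltedLaw {𝕏 : Type*} [MeasurableSpace 𝕏] (h : ℝ → ℝ)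
    (L : Measure (Measure 𝕏)) : Measure (Measure 𝕏) :=
  (∫⁻ μ, ENNReal.ofReal (h (μ Set.univ).toReal) ∂L)⁻¹ •
    L.withDensity (fun μ => ENNReal.ofReal (h (μ Set.univ).toReal))

/-- The joint law of a random measure `μt`, a sample `X = (X₁, …, Xₙ)` and an auxiliary
variable `U` on a probability space `(Ω, P)`: given `μt`, the `Xᵢ` are i.i.d. from the normalized
measure `μt / μt(𝕏)`, and, independently of them, `U` is gamma with shape `n + q` and rate
`μt(𝕏)`. Hence, if `T = μt(𝕏)` has density `f`, then `(U, T)` has the density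
`u^(n+q-1) e^(-u y) y^(n+q) f(y) / Γ(n+q)`. -/
structure IsAugmentedSample {Ω 𝕏 : Type*} [MeasurableSpace Ω] [MeasurableSpace 𝕏]
    (P : Measure Ω) (q : ℝ) {n : ℕ} (μt : Ω → Measure 𝕏) (X : Ω → Fin n → 𝕏) (U : Ω → ℝ) :
    Prop where
  measurable_measure : Measurable μt
  measurable_sample : Measurable X
  measurable_aux : Measurable U
  joint_law : ∀ (A : Set (Measure 𝕏)) (B : Fin n → Set 𝕏) (C : Set ℝ),
    MeasurableSet A → (∀ i, MeasurableSet (B i)) → MeasurableSet C →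
    P {ω | μt ω ∈ A ∧ (∀ i, X ω i ∈ B i) ∧ U ω ∈ C} =
      ∫⁻ ω in μt ⁻¹' A, (∏ i, μt ω (B i) / μt ω Set.univ) *
        gammaMeasure (n + q) (μt ω Set.univ).toReal C ∂P

/-! ### Ties -/

/-- Partitions of the index set of an `n`-sample. -/
abbrev IndexPartition (n : ℕ) : Type := Finpartition (Finset.univ : Finset (Fin n))

open Classical in
/-- The partition `p_n` of the indices induced by the ties: `i` and `j` are in the same cell iff
`x i = x j`. -/
noncomputable def tiePartition {𝕏 : Type*} {n : ℕ} (x : Fin n → 𝕏) : IndexPartition n :=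
  Finpartition.ofSetoid (Setoid.ker x)

theorem mem_part_tiePartition {𝕏 : Type*} {n : ℕ} (x : Fin n → 𝕏) (i j : Fin n) :
    j ∈ (tiePartition x).part i ↔ x i = x j := by
  classical
  unfold tiePartition
  rw [Finpartition.mem_part_ofSetoid_iff_rel]
  exact Setoid.ker_def

/-- The values `(Y_c)` indexed by the cells `c` of `p`, read off at the smallest index of each
cell. When `p` is the partition induced by the ties of `x`, `x i = Y_c` for every `i ∈ c`. -/
def cellValues {𝕏 : Type*} {n : ℕ} (p : IndexPartition n) (x : Fin n → 𝕏) :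
    {c // c ∈ p.parts} → 𝕏 :=
  fun c => x (c.1.min' (p.nonempty_of_mem_parts c.2))

/-! ### The functions in the formulas, with values in `[0, ∞]` -/

/-- `ψ_a(b) = ∫ (1 - e^{-b s}) e^{-a s} ρ_x(ds) η(dx)`. -/
noncomputable def psi {𝕏 : Type*} [MeasurableSpace 𝕏] (η : Measure 𝕏) (ρ : Kernel 𝕏 ℝ)
    (a b : ℝ) : ℝ≥0∞ :=
  ∫⁻ x, ∫⁻ s, ENNReal.ofReal ((1 - Real.exp (-(b * s))) * Real.exp (-(a * s))) ∂(ρ x) ∂η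

/-- `τ_{m,z}(a) = ∫ s^m e^{-s a} ρ_z(ds)`. -/
noncomputable def tau {𝕏 : Type*} [MeasurableSpace 𝕏] (ρ : Kernel 𝕏 ℝ)
    (m : ℕ) (z : 𝕏) (a : ℝ) : ℝ≥0∞ :=
  ∫⁻ s, ENNReal.ofReal (s ^ m * Real.exp (-(s * a))) ∂(ρ z)

/-- `κ_m(a) = ∫ τ_{m,x}(a) η(dx)`. -/
noncomputable def kappa {𝕏 : Type*} [MeasurableSpace 𝕏] (η : Measure 𝕏) (ρ : Kernel 𝕏 ℝ)
    (m : ℕ) (a : ℝ) : ℝ≥0∞ :=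
  ∫⁻ x, tau ρ m x a ∂η

/-- `e^{-ψ_0(γ + u)} · w · u^{n + q - 1}`; here `ψ_0(γ + u)` is finite in all uses. -/
noncomputable def uWeight {𝕏 : Type*} [MeasurableSpace 𝕏] (η : Measure 𝕏) (ρ : Kernel 𝕏 ℝ)
    (γ q : ℝ) (n : ℕ) (u : ℝ) (w : ℝ≥0∞) : ℝ≥0∞ :=
  ENNReal.ofReal (Real.exp (-(psi η ρ 0 (γ + u)).toReal)) * w *
    ENNReal.ofReal (u ^ ((n : ℝ) + q - 1))

/-- `∏_k τ_{n_k, Y_k}(a)` over the cells of `p`. -/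
noncomputable def tauProd {𝕏 : Type*} [MeasurableSpace 𝕏] (ρ : Kernel 𝕏 ℝ) {n : ℕ}
    (p : IndexPartition n) (y : {c // c ∈ p.parts} → 𝕏) (a : ℝ) : ℝ≥0∞ :=
  ∏ c : {c // c ∈ p.parts}, tau ρ c.1.card (y c) a

/-- `∏_k κ_{n_k}(a)` over the cells of `p`. -/
noncomputable def kappaProd {𝕏 : Type*} [MeasurableSpace 𝕏] (η : Measure 𝕏) (ρ : Kernel 𝕏 ℝ)
    {n : ℕ} (p : IndexPartition n) (a : ℝ) : ℝ≥0∞ :=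
  ∏ c ∈ p.parts, kappa η ρ c.card a

/-- `∫_0^∞ e^{-ψ_0(γ+u)} ∏_k τ_{n_k, Y_k}(γ+u) u^{n+q-1} du`. -/
noncomputable def tauIntegral {𝕏 : Type*} [MeasurableSpace 𝕏] (η : Measure 𝕏) (ρ : Kernel 𝕏 ℝ)
    (γ q : ℝ) {n : ℕ} (p : IndexPartition n) (y : {c // c ∈ p.parts} → 𝕏) : ℝ≥0∞ :=
  ∫⁻ u in Set.Ioi (0 : ℝ), uWeight η ρ γ q n u (tauProd ρ p y (γ + u))

/-- `∫_0^∞ e^{-ψ_0(γ+u)} ∏_k κ_{n_k}(γ+u) u^{n+q-1} du`. -/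
noncomputable def kappaIntegral {𝕏 : Type*} [MeasurableSpace 𝕏] (η : Measure 𝕏)
    (ρ : Kernel 𝕏 ℝ) (γ q : ℝ) {n : ℕ} (p : IndexPartition n) : ℝ≥0∞ :=
  ∫⁻ u in Set.Ioi (0 : ℝ), uWeight η ρ γ q n u (kappaProd η ρ p (γ + u))

end TiltedCRM

/-! Write `T` for the total mass of the completely random measure. The proof rests on a
cancellation. The tilt contributes `e^{-γT} T^{-q}`, the normalization of `n` draws contributes
`T^{-n}`, and the gamma density contributes `T^{n+q} u^{n+q-1} e^{-uT} / Γ(n+q)`. The powers of `T`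
disappear (`tilt_mul_div_pow_mul_gamma`), so the event that every `X_i` lies in `B_i` and `U` lies
in `C` has probability a constant times the integral over `C` of `u^{n+q-1} E[e^{-(γ+u)T} ∏
μ̃(B_i)]`.

That expectation is a moment of a Poisson process `N`, of the form `E[e^{-N f} ∏ N(g_i)]`.
Differentiating the Laplace functional gives a Mecke formula: a factor `N(g_j)` can be replaced by
integration over an added point `x`, and every other `N(g_i)` becomes `N(g_i) + g_i(x)`. Expanding
this product over the set of indices that use `x` singles out the cell containing `j`. Sums over
partitions satisfy the same recursion (`sum_finpartition_insert`), so the moment equals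
`e^{-ψ_0(γ+u)}` times a sum over partitions of products, over the cells, of integrals of `τ` against
`η`.

On rectangles the sample law is thus a mixture over partitions `p` of images under `spread p`, which
repeats one value along each cell. Rectangles determine the law. As `η` has no atoms, values on
different cells are almost surely distinct, so the `p`-th component lives on samples whose ties are
exactly `p`. This gives the joint law of ties, values and `U` up to a constant, which is forced by
total mass one; the same argument shows that each `I(p)` is finite. The five formulas are marginals
and conditionals of this joint law.

All integrals take values in `[0, ∞]`, so Tonelli needs no integrability check; finiteness matters
only where something is subtracted, cancelled or divided. -/

namespace TiltedCRM

/-! ### The function `x ↦ e^{-x}` on `[0, ∞]` -/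

/-- `e^{-x}` for `x ∈ [0, ∞]`. -/
noncomputable def expNeg (x : ℝ≥0∞) : ℝ≥0∞ := EReal.exp (-(x : EReal))

@[simp] theorem expNeg_zero : expNeg 0 = 1 := by simp [expNeg]

@[simp] theorem expNeg_top : expNeg ∞ = 0 := by simp [expNeg]

theorem expNeg_coe (x : ℝ≥0) : expNeg x = ENNReal.ofReal (Real.exp (-x)) := by
  rw [expNeg, EReal.coe_nnreal_eq_coe_real, ← EReal.coe_neg, EReal.exp_coe]

theorem expNeg_ofReal {x : ℝ} (hx : 0 ≤ x) :
    expNeg (ENNReal.ofReal x) = ENNReal.ofReal (Real.exp (-x)) := by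
  rw [ENNReal.ofReal, expNeg_coe, Real.coe_toNNReal x hx]

theorem expNeg_of_ne_top {x : ℝ≥0∞} (hx : x ≠ ∞) :
    expNeg x = ENNReal.ofReal (Real.exp (-x.toReal)) := by
  rw [← expNeg_ofReal ENNReal.toReal_nonneg, ENNReal.ofReal_toReal hx]

theorem expNeg_add (x y : ℝ≥0∞) : expNeg (x + y) = expNeg x * expNeg y := by
  simp only [expNeg, EReal.coe_ennreal_add]
  rw [EReal.neg_add (by simp) (by simp), sub_eq_add_neg, EReal.exp_add]

theorem expNeg_antitone : Antitone expNeg := fun _ _ h =>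
  EReal.exp_monotone (EReal.neg_le_neg_iff.2 (EReal.coe_ennreal_le_coe_ennreal_iff.2 h))

theorem expNeg_le_one (x : ℝ≥0∞) : expNeg x ≤ 1 := by
  simpa using expNeg_antitone (zero_le (a := x))

theorem expNeg_ne_top (x : ℝ≥0∞) : expNeg x ≠ ∞ :=
  ((expNeg_le_one x).trans_lt ENNReal.one_lt_top).ne

theorem expNeg_pos {x : ℝ≥0∞} (hx : x ≠ ∞) : 0 < expNeg x := by
  rw [expNeg_of_ne_top hx, ENNReal.ofReal_pos]
  exact Real.exp_pos _

theorem continuous_expNeg : Continuous expNeg :=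
  ENNReal.continuous_exp.comp (continuous_neg.comp continuous_coe_ennreal_ereal)

@[fun_prop]
theorem measurable_expNeg : Measurable expNeg := continuous_expNeg.measurable

theorem expNeg_sum {ι : Type*} (s : Finset ι) (f : ι → ℝ≥0∞) :
    expNeg (∑ i ∈ s, f i) = ∏ i ∈ s, expNeg (f i) := by
  classical
  induction s using Finset.induction_on with
  | empty => simp
  | insert a s ha ih => rw [Finset.sum_insert ha, Finset.prod_insert ha, expNeg_add, ih]

theorem expNeg_mul_natCast (c : ℝ≥0∞) (k : ℕ) : expNeg (c * k) = expNeg c ^ k := by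
  induction k with
  | zero => simp
  | succ k ih => rw [Nat.cast_succ, mul_add, mul_one, expNeg_add, ih, pow_succ]

theorem one_sub_expNeg_le (x : ℝ≥0∞) : 1 - expNeg x ≤ x := by
  rcases eq_or_ne x ∞ with rfl | hx
  · simp
  · rw [expNeg_of_ne_top hx, ← ENNReal.ofReal_one, ← ENNReal.ofReal_sub _ (Real.exp_pos _).le]
    refine ENNReal.ofReal_le_of_le_toReal ?_
    linarith [Real.add_one_le_exp (-x.toReal)]

/-! ### The Laplace functional of a Poisson process -/

/-- This is the Poisson generating function `e^{-r(1-t)}` at `t = e^{-c}`; `c = ∞` is included as `t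
= 0`. -/
theorem lintegral_expNeg_poissonMeasure (r : ℝ≥0) (c : ℝ≥0∞) :
    ∫⁻ k : ℕ, expNeg (c * k) ∂(poissonMeasure r) = expNeg (r * (1 - expNeg c)) := by
  have hc : expNeg c = ENNReal.ofReal (expNeg c).toReal :=
    (ENNReal.ofReal_toReal (expNeg_ne_top c)).symm
  set t := (expNeg c).toReal with ht
  have ht0 : 0 ≤ t := ENNReal.toReal_nonneg
  have ht1 : t ≤ 1 := by
    have := ENNReal.toReal_mono ENNReal.one_ne_top (expNeg_le_one c)
    simpa using this
  have hsum : HasSum (fun k : ℕ => Real.exp (-r) * r ^ k / (k.factorial : ℝ) * t ^ k)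
      (Real.exp (-(r * (1 - t)))) := by
    have h := (NormedSpace.expSeries_div_hasSum_exp (r * t : ℝ)).mul_left (Real.exp (-r))
    rw [← Real.exp_eq_exp_ℝ, ← Real.exp_add] at h
    convert! h using 1
    · ext k; rw [mul_pow]; ring
    · congr 1; ring
  rw [poissonMeasure, lintegral_sum_measure]
  simp_rw [lintegral_smul_measure, lintegral_dirac, expNeg_mul_natCast, hc, smul_eq_mul,
    ← ENNReal.ofReal_pow ht0]
  have h2 : ∀ k : ℕ, ENNReal.ofReal (Real.exp (-r) * r ^ k / (k.factorial : ℝ)) *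
      ENNReal.ofReal (t ^ k) =
        ENNReal.ofReal (Real.exp (-r) * r ^ k / (k.factorial : ℝ) * t ^ k) :=
    fun k => (ENNReal.ofReal_mul (by positivity)).symm
  simp_rw [h2]
  rw [← ENNReal.ofReal_tsum_of_nonneg (fun k => by positivity) hsum.summable, hsum.tsum_eq,
    ← ENNReal.ofReal_one, ← ENNReal.ofReal_sub _ ht0, ← ENNReal.ofReal_coe_nnreal,
    ← ENNReal.ofReal_mul (by positivity),
    expNeg_ofReal (mul_nonneg r.coe_nonneg (sub_nonneg.2 ht1))]

variable {Ω E : Type*} [MeasurableSpace Ω] [MeasurableSpace E] {P : Measure Ω}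
  {N : Ω → Measure E} {ν : Measure E}

namespace IsPoissonProcess

theorem measurable_apply (hN : IsPoissonProcess P N ν) {B : Set E} (hB : MeasurableSet B) :
    Measurable fun ω => N ω B :=
  (Measure.measurable_coe hB).comp hN.measurable

@[fun_prop]
theorem measurable_lintegral (hN : IsPoissonProcess P N ν) {f : E → ℝ≥0∞} (hf : Measurable f) :
    Measurable fun ω => ∫⁻ x, f x ∂(N ω) :=
  (Measure.measurable_lintegral hf).comp hN.measurable

/-- The law of `N B` is prescribed only for finite intensity, hence the guard; for `c = 0` both
sides are `1` whatever `ν B` is. -/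
theorem lintegral_expNeg_mul_apply (hN : IsPoissonProcess P N ν) [IsProbabilityMeasure P]
    {B : Set E} (hB : MeasurableSet B) (c : ℝ≥0∞) (hc : c ≠ 0 → ν B ≠ ∞) :
    ∫⁻ ω, expNeg (c * N ω B) ∂P = expNeg ((1 - expNeg c) * ν B) := by
  by_cases hc0 : c = 0
  · simp [hc0]
  have hν := hc hc0
  rw [← lintegral_map (f := fun y => expNeg (c * y)) (g := fun ω => N ω B) (by fun_prop)
    (hN.measurable_apply hB), hN.law B hB hν,
    lintegral_map (by fun_prop) (measurable_of_countable _), lintegral_expNeg_poissonMeasure,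
    ENNReal.coe_toNNReal hν, mul_comm]

/-- The level sets are disjoint, so the exponential splits into independent factors, one for each
value. -/
theorem lintegral_expNeg_simpleFunc (hN : IsPoissonProcess P N ν) [IsProbabilityMeasure P]
    (φ : SimpleFunc E ℝ≥0∞) (hφ : ∀ c, c ≠ 0 → ν (φ ⁻¹' {c}) ≠ ∞) :
    ∫⁻ ω, expNeg (∫⁻ x, φ x ∂(N ω)) ∂P = expNeg (∫⁻ x, (1 - expNeg (φ x)) ∂ν) := by
  have hr : ∫⁻ x, (1 - expNeg (φ x)) ∂ν = ∑ c ∈ φ.range, (1 - expNeg c) * ν (φ ⁻¹' {c}) := by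
    rw [← SimpleFunc.map_lintegral, ← SimpleFunc.lintegral_eq_lintegral]
    rfl
  have key : ∀ ω, expNeg (∫⁻ x, φ x ∂(N ω)) =
      ∏ i : Fin φ.range.card,
        expNeg ((φ.range.equivFin.symm i : ℝ≥0∞) * N ω (φ ⁻¹' {(φ.range.equivFin.symm i : ℝ≥0∞)})) := by
    intro ω
    rw [SimpleFunc.lintegral_eq_lintegral, SimpleFunc.lintegral, expNeg_sum,
      ← Finset.prod_coe_sort, ← φ.range.equivFin.symm.prod_comp]
  simp_rw [key]
  have hind := hN.indep φ.range.card
    (fun i => φ ⁻¹' {(φ.range.equivFin.symm i : ℝ≥0∞)}) (fun i => φ.measurableSet_preimage _)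
    (fun i j hij => by
      refine Disjoint.preimage _ (Set.disjoint_singleton.2 fun h => hij ?_)
      exact φ.range.equivFin.symm.injective (Subtype.ext h))
  have hind2 := hind.comp (g := fun i y => expNeg ((φ.range.equivFin.symm i : ℝ≥0∞) * y))
    (fun i => by fun_prop)
  have h3 := lintegral_prod_eq_prod_lintegral_of_indepFun Finset.univ _ hind2
    (fun i => (measurable_expNeg.comp (measurable_const.mul
      (hN.measurable_apply (φ.measurableSet_preimage _)))))
  simp only [Function.comp_def] at h3
  rw [h3, hr, expNeg_sum, ← Finset.prod_coe_sort φ.range, ← φ.range.equivFin.symm.prod_comp]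
  refine Finset.prod_congr rfl fun i _ => ?_
  exact hN.lintegral_expNeg_mul_apply (φ.measurableSet_preimage _) _ (hφ _)

/-- The Laplace functional of a Poisson process. -/
theorem lintegral_expNeg_lintegral (hN : IsPoissonProcess P N ν) [IsProbabilityMeasure P]
    [SigmaFinite ν] {f : E → ℝ≥0∞} (hf : Measurable f) :
    ∫⁻ ω, expNeg (∫⁻ x, f x ∂(N ω)) ∂P = expNeg (∫⁻ x, (1 - expNeg (f x)) ∂ν) := by
  -- Cutting off outside the spanning sets gives every nonzero level set finite intensity.
  let φ : ℕ → SimpleFunc E ℝ≥0∞ := fun m =>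
    (SimpleFunc.eapprox f m).restrict (spanningSets ν m)
  have hφ_apply : ∀ m x, φ m x = (spanningSets ν m).indicator (SimpleFunc.eapprox f m) x :=
    fun m x => by
      rw [SimpleFunc.restrict_apply _ (measurableSet_spanningSets ν m)]
  have hmono : ∀ x, Monotone fun m => φ m x := by
    intro x m k hmk
    simp only [hφ_apply]
    refine (Set.indicator_le_indicator (SimpleFunc.monotone_eapprox f hmk x)).trans ?_
    exact Set.indicator_le_indicator_of_subset (monotone_spanningSets ν hmk)
      (fun _ => zero_le) x
  have hlim : ∀ x, Filter.Tendsto (fun m => φ m x) Filter.atTop (nhds (f x)) := by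
    intro x
    have h1 : Filter.Tendsto (fun m => SimpleFunc.eapprox f m x) Filter.atTop (nhds (f x)) :=
      SimpleFunc.tendsto_eapprox hf x
    refine h1.congr' ?_
    filter_upwards [Filter.eventually_ge_atTop (spanningSetsIndex ν x)] with m hm
    rw [hφ_apply, Set.indicator_of_mem]
    exact monotone_spanningSets ν hm (mem_spanningSetsIndex ν x)
  have hsimple : ∀ m, ∫⁻ ω, expNeg (∫⁻ x, φ m x ∂(N ω)) ∂P =
      expNeg (∫⁻ x, (1 - expNeg (φ m x)) ∂ν) := by
    intro m
    refine hN.lintegral_expNeg_simpleFunc (φ m) fun c hc => ?_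
    refine ((measure_mono ?_).trans_lt (measure_spanningSets_lt_top ν m)).ne
    intro x hx
    by_contra hx'
    rw [Set.mem_preimage, hφ_apply, Set.indicator_of_notMem hx', Set.mem_singleton_iff] at hx
    exact hc hx.symm
  -- The left side is bounded by `1` under a probability measure, so dominated convergence applies.
  -- On the right `1 - e^{-φ}` increases, so monotone convergence works even when the limit is
  -- infinite.
  have hL : Filter.Tendsto (fun m => ∫⁻ ω, expNeg (∫⁻ x, φ m x ∂(N ω)) ∂P) Filter.atTop
      (nhds (∫⁻ ω, expNeg (∫⁻ x, f x ∂(N ω)) ∂P)) := by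
    refine tendsto_lintegral_of_dominated_convergence (fun _ => 1)
      (fun m => measurable_expNeg.comp (hN.measurable_lintegral (φ m).measurable))
      (fun m => Filter.Eventually.of_forall fun ω => expNeg_le_one _) (by simp) ?_
    refine Filter.Eventually.of_forall fun ω => ?_
    refine (continuous_expNeg.tendsto _).comp ?_
    exact lintegral_tendsto_of_tendsto_of_monotone (fun m => (φ m).measurable.aemeasurable)
      (Filter.Eventually.of_forall hmono) (Filter.Eventually.of_forall hlim)
  have hR : Filter.Tendsto (fun m => expNeg (∫⁻ x, (1 - expNeg (φ m x)) ∂ν)) Filter.atTop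
      (nhds (expNeg (∫⁻ x, (1 - expNeg (f x)) ∂ν))) := by
    refine (continuous_expNeg.tendsto _).comp ?_
    refine lintegral_tendsto_of_tendsto_of_monotone
      (fun m => (measurable_const.sub (measurable_expNeg.comp (φ m).measurable)).aemeasurable)
      (Filter.Eventually.of_forall fun x m k hmk =>
        tsub_le_tsub_left (expNeg_antitone (hmono x hmk)) 1)
      (Filter.Eventually.of_forall fun x => ?_)
    exact ENNReal.Tendsto.sub tendsto_const_nhds
      ((continuous_expNeg.tendsto _).comp (hlim x)) (Or.inl ENNReal.one_ne_top)
  simp_rw [hsimple] at hL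
  exact tendsto_nhds_unique hL hR

end IsPoissonProcess
end TiltedCRM

namespace TiltedCRM

/-! ### Difference quotients of `x ↦ e^{-x}` -/

/-- A rearrangement of `1 + y ≤ e^y`; it squeezes the difference quotients from below. -/
theorem div_one_add_le_one_sub_expNeg {y : ℝ≥0∞} (hy : y ≠ ∞) :
    y / (1 + y) ≤ 1 - expNeg y := by
  lift y to ℝ≥0 using hy
  have hy0 : (0 : ℝ) ≤ y := y.coe_nonneg
  have h1 : (y : ℝ≥0∞) / (1 + y) = ENNReal.ofReal (y / (1 + y)) := by
    rw [ENNReal.ofReal_div_of_pos (by positivity), ENNReal.ofReal_add zero_le_one hy0]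
    simp
  rw [h1, expNeg_coe, ← ENNReal.ofReal_one, ← ENNReal.ofReal_sub _ (Real.exp_pos _).le]
  refine ENNReal.ofReal_le_ofReal ?_
  rw [Real.exp_neg]
  have h2 : (Real.exp y)⁻¹ ≤ (1 + (y : ℝ))⁻¹ :=
    inv_anti₀ (by positivity) (by linarith [Real.add_one_le_exp (y : ℝ)])
  have h3 : (y : ℝ) / (1 + y) = 1 - (1 + (y : ℝ))⁻¹ := by
    field_simp
    ring
  linarith

/-- The difference quotient `(k + 1) (1 - e^{-x / (k + 1)})`. -/
noncomputable def expSlope (k : ℕ) (x : ℝ≥0∞) : ℝ≥0∞ :=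
  (k + 1) * (1 - expNeg ((k + 1 : ℝ≥0∞)⁻¹ * x))

@[fun_prop]
theorem measurable_expSlope (k : ℕ) : Measurable (expSlope k) := by
  unfold expSlope
  fun_prop

theorem expSlope_le (k : ℕ) (x : ℝ≥0∞) : expSlope k x ≤ x := by
  refine (mul_le_mul_right (one_sub_expNeg_le _) _).trans ?_
  rw [← mul_assoc, ENNReal.mul_inv_cancel (by simp) (by finiteness), one_mul]

/-- The quotient lies between `v k / (1 + L / (k + 1))` and `v k`. Finiteness of `L` sends the
denominator to `1`. A moving argument is needed when the Laplace exponent itself is differentiated.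
-/
theorem tendsto_expSlope_of_tendsto {v : ℕ → ℝ≥0∞} {L : ℝ≥0∞} (hL : L ≠ ∞)
    (hv : ∀ k, v k ≤ L) (hlim : Filter.Tendsto v Filter.atTop (nhds L)) :
    Filter.Tendsto (fun k => expSlope k (v k)) Filter.atTop (nhds L) := by
  have hinv : Filter.Tendsto (fun k : ℕ => (k + 1 : ℝ≥0∞)⁻¹) Filter.atTop (nhds 0) := by
    have := (Filter.tendsto_add_atTop_iff_nat 1).2 ENNReal.tendsto_inv_nat_nhds_zero
    simpa using this
  have hlow : Filter.Tendsto (fun k : ℕ => v k / (1 + (k + 1 : ℝ≥0∞)⁻¹ * L)) Filter.atTop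
      (nhds L) := by
    have h1 : Filter.Tendsto (fun k : ℕ => 1 + (k + 1 : ℝ≥0∞)⁻¹ * L) Filter.atTop (nhds 1) := by
      have := (ENNReal.Tendsto.mul_const (b := L) hinv (Or.inr hL)).const_add 1
      simpa using this
    have := ENNReal.Tendsto.div hlim (Or.inr one_ne_zero) h1 (Or.inr hL)
    simpa using this
  refine tendsto_of_tendsto_of_tendsto_of_le_of_le hlow hlim (fun k => ?_)
    (fun k => expSlope_le k (v k))
  have hk0 : (k + 1 : ℝ≥0∞) ≠ 0 := by simp
  have hkt : (k + 1 : ℝ≥0∞) ≠ ∞ := by finiteness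
  have hvt : v k ≠ ∞ := ne_top_of_le_ne_top hL (hv k)
  have hkey := div_one_add_le_one_sub_expNeg
    (y := (k + 1 : ℝ≥0∞)⁻¹ * v k) (ENNReal.mul_ne_top (ENNReal.inv_ne_top.2 hk0) hvt)
  calc v k / (1 + (k + 1 : ℝ≥0∞)⁻¹ * L)
      ≤ v k / (1 + (k + 1 : ℝ≥0∞)⁻¹ * v k) := by
        gcongr
        exact hv k
    _ = (k + 1) * ((k + 1 : ℝ≥0∞)⁻¹ * v k / (1 + (k + 1 : ℝ≥0∞)⁻¹ * v k)) := by
        rw [← mul_div_assoc, ← mul_assoc, ENNReal.mul_inv_cancel hk0 hkt, one_mul]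
    _ ≤ expSlope k (v k) := by
        unfold expSlope
        gcongr

theorem tendsto_expSlope (x : ℝ≥0∞) :
    Filter.Tendsto (fun k => expSlope k x) Filter.atTop (nhds x) := by
  rcases eq_or_ne x ∞ with rfl | hx
  · have h : ∀ k : ℕ, expSlope k ∞ = ((k + 1 : ℕ) : ℝ≥0∞) := by
      intro k
      unfold expSlope
      rw [ENNReal.mul_top (ENNReal.inv_ne_zero.2 (by finiteness))]
      simp
    simp_rw [h]
    exact (Filter.tendsto_add_atTop_iff_nat (f := fun k : ℕ => (k : ℝ≥0∞)) 1).2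
      ENNReal.tendsto_nat_nhds_top
  · exact tendsto_expSlope_of_tendsto hx (fun _ => le_rfl) tendsto_const_nhds

/-! ### Convergence from below in `[0, ∞]` -/

/-- Multiplication on `[0, ∞]` is discontinuous at `(0, ∞)`. Approach from below removes the
problem: a factor with limit `0` is identically `0`. -/
theorem tendsto_mul_of_le {ι : Type*} {l : Filter ι} {u v : ι → ℝ≥0∞} {a b : ℝ≥0∞}
    (hu : ∀ i, u i ≤ a) (hv : ∀ i, v i ≤ b) (ha : Filter.Tendsto u l (nhds a))
    (hb : Filter.Tendsto v l (nhds b)) :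
    Filter.Tendsto (fun i => u i * v i) l (nhds (a * b)) := by
  rcases eq_or_ne a 0 with rfl | ha0
  · have : ∀ i, u i = 0 := fun i => le_antisymm (hu i) zero_le
    simpa [this] using tendsto_const_nhds
  rcases eq_or_ne b 0 with rfl | hb0
  · have : ∀ i, v i = 0 := fun i => le_antisymm (hv i) zero_le
    simpa [this] using tendsto_const_nhds
  exact ENNReal.Tendsto.mul ha (Or.inl ha0) hb (Or.inl hb0)

theorem tendsto_finset_prod_of_le {ι κ : Type*} {l : Filter ι} (s : Finset κ)
    {u : κ → ι → ℝ≥0∞} {a : κ → ℝ≥0∞} (hu : ∀ j i, u j i ≤ a j)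
    (ha : ∀ j, Filter.Tendsto (u j) l (nhds (a j))) :
    Filter.Tendsto (fun i => ∏ j ∈ s, u j i) l (nhds (∏ j ∈ s, a j)) := by
  classical
  induction s using Finset.induction_on with
  | empty => simpa using tendsto_const_nhds
  | insert j s hj ih =>
    simp_rw [Finset.prod_insert hj]
    exact tendsto_mul_of_le (hu j) (fun i => Finset.prod_le_prod' fun k _ => hu k i) (ha j) ih

/-- Fatou bounds the limit from below, and the pointwise bound by `a` does so from above. Neither
monotonicity nor an integrable majorant is required. -/
theorem tendsto_lintegral_of_le {α : Type*} [MeasurableSpace α] {μ : Measure α}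
    {u : ℕ → α → ℝ≥0∞} {a : α → ℝ≥0∞} (hum : ∀ k, Measurable (u k)) (hu : ∀ k x, u k x ≤ a x)
    (ha : ∀ x, Filter.Tendsto (fun k => u k x) Filter.atTop (nhds (a x))) :
    Filter.Tendsto (fun k => ∫⁻ x, u k x ∂μ) Filter.atTop (nhds (∫⁻ x, a x ∂μ)) := by
  refine tendsto_of_le_liminf_of_limsup_le ?_ ?_
  · calc ∫⁻ x, a x ∂μ = ∫⁻ x, Filter.liminf (fun k => u k x) Filter.atTop ∂μ :=
          lintegral_congr fun x => (ha x).liminf_eq.symm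
      _ ≤ _ := lintegral_liminf_le hum
  · exact Filter.limsup_le_of_le (h := Filter.Eventually.of_forall fun k =>
      lintegral_mono (hu k))

/-! ### The Mecke formula for products of linear functionals -/

variable {Ω E : Type*} [MeasurableSpace Ω] [MeasurableSpace E] {P : Measure Ω}
  {N : Ω → Measure E} {ν : Measure E}

namespace IsPoissonProcess

/-- Differentiate the Laplace functional at `f + ε g` at `ε = 0`, with `ε = 1 / (k + 1)`. The
exponent changes by the integral of `(1 - e^{-εg}) e^{-f}`, whose quotient by `ε` tends to the
integral of `g e^{-f}`. -/
theorem lintegral_mul_expNeg (hN : IsPoissonProcess P N ν) [IsProbabilityMeasure P]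
    [SigmaFinite ν] {f g : E → ℝ≥0∞} (hf : Measurable f) (hg : Measurable g)
    (hfg : ∫⁻ x, g x * expNeg (f x) ∂ν ≠ ∞) :
    ∫⁻ ω, (∫⁻ x, g x ∂(N ω)) * expNeg (∫⁻ x, f x ∂(N ω)) ∂P =
      (∫⁻ x, g x * expNeg (f x) ∂ν) * ∫⁻ ω, expNeg (∫⁻ x, f x ∂(N ω)) ∂P := by
  have hNf := hN.measurable_lintegral hf
  have hNg := hN.measurable_lintegral hg
  set L := ∫⁻ x, g x * expNeg (f x) ∂ν with hLdef
  set ψ := ∫⁻ x, (1 - expNeg (f x)) ∂ν with hψ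
  let v : ℕ → ℝ≥0∞ := fun k => ∫⁻ x, expSlope k (g x) * expNeg (f x) ∂ν
  have hvL : ∀ k, v k ≤ L := fun k =>
    lintegral_mono fun x => mul_le_mul_left (expSlope_le k (g x)) _
  have hv : Filter.Tendsto v Filter.atTop (nhds L) :=
    tendsto_lintegral_of_le (fun k => by fun_prop)
      (fun k x => mul_le_mul_left (expSlope_le k (g x)) _)
      (fun x => ENNReal.Tendsto.mul_const (tendsto_expSlope _) (Or.inr (expNeg_ne_top _)))
  have hA : Filter.Tendsto (fun k => ∫⁻ ω, expSlope k (∫⁻ x, g x ∂(N ω)) *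
      expNeg (∫⁻ x, f x ∂(N ω)) ∂P) Filter.atTop
      (nhds (∫⁻ ω, (∫⁻ x, g x ∂(N ω)) * expNeg (∫⁻ x, f x ∂(N ω)) ∂P)) :=
    tendsto_lintegral_of_le (fun k => by fun_prop)
      (fun k x => mul_le_mul_left (expSlope_le k _) _)
      (fun x => ENNReal.Tendsto.mul_const (tendsto_expSlope _) (Or.inr (expNeg_ne_top _)))
  have hB : Filter.Tendsto (fun k => expSlope k (v k) * expNeg ψ) Filter.atTop
      (nhds (L * expNeg ψ)) :=
    ENNReal.Tendsto.mul_const (tendsto_expSlope_of_tendsto hfg hvL hv) (Or.inr (expNeg_ne_top _))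
  have hAB : ∀ k, ∫⁻ ω, expSlope k (∫⁻ x, g x ∂(N ω)) * expNeg (∫⁻ x, f x ∂(N ω)) ∂P =
      expSlope k (v k) * expNeg ψ := by
    intro k
    have hk0 : (k + 1 : ℝ≥0∞) ≠ 0 := by simp
    have hkt : (k + 1 : ℝ≥0∞) ≠ ∞ := by finiteness
    -- The increment is written as a sum because subtraction truncates; the finite second term is
    -- moved across in `h5`.
    have h1 : ∫⁻ ω, (1 - expNeg ((k + 1 : ℝ≥0∞)⁻¹ * ∫⁻ x, g x ∂(N ω))) *
        expNeg (∫⁻ x, f x ∂(N ω)) ∂P + expNeg ψ * expNeg ((k + 1 : ℝ≥0∞)⁻¹ * v k) =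
          expNeg ψ := by
      have h2 : expNeg ψ * expNeg ((k + 1 : ℝ≥0∞)⁻¹ * v k) =
          ∫⁻ ω, expNeg ((k + 1 : ℝ≥0∞)⁻¹ * ∫⁻ x, g x ∂(N ω)) *
            expNeg (∫⁻ x, f x ∂(N ω)) ∂P := by
        have h3 := hN.lintegral_expNeg_lintegral
          (f := fun x => (k + 1 : ℝ≥0∞)⁻¹ * g x + f x) (by fun_prop)
        have h4 : ∫⁻ x, (1 - expNeg ((k + 1 : ℝ≥0∞)⁻¹ * g x + f x)) ∂ν =
            ψ + (k + 1 : ℝ≥0∞)⁻¹ * v k := by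
          simp only [v]
          rw [hψ, ← lintegral_const_mul _ (by fun_prop), ← lintegral_add_left (by fun_prop)]
          refine lintegral_congr fun x => ?_
          unfold expSlope
          rw [← mul_assoc, ← mul_assoc, ENNReal.inv_mul_cancel hk0 hkt, one_mul, expNeg_add,
            ENNReal.sub_mul (fun _ _ => expNeg_ne_top _), one_mul,
            tsub_add_tsub_cancel (expNeg_le_one _)]
          exact mul_le_of_le_one_left' (expNeg_le_one _)
        rw [h4, expNeg_add] at h3
        rw [← h3]
        refine lintegral_congr fun ω => ?_
        rw [lintegral_add_left (by fun_prop), lintegral_const_mul _ hg, expNeg_add]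
      rw [h2, ← lintegral_add_left (by fun_prop), hψ, ← hN.lintegral_expNeg_lintegral hf]
      refine lintegral_congr fun ω => ?_
      rw [← add_mul, tsub_add_cancel_of_le (expNeg_le_one _), one_mul]
    have h5 := ENNReal.eq_sub_of_add_eq
      (ENNReal.mul_ne_top (expNeg_ne_top _) (expNeg_ne_top _)) h1
    unfold expSlope
    simp_rw [mul_assoc]
    rw [lintegral_const_mul _ (by fun_prop), h5,
      ENNReal.sub_mul (fun _ _ => expNeg_ne_top _), one_mul, mul_comm (expNeg ψ)]
  rw [hN.lintegral_expNeg_lintegral hf]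
  simp_rw [hAB] at hA
  exact tendsto_nhds_unique hA hB

/-- Expanding one factor `1 - e^{-N h_j}` produces the same expression with `f` and with `f + h_j`,
so induction with `f` free reduces everything to the empty product. Bounded factors keep the
subtracted terms finite. -/
theorem lintegral_mul_expNeg_mul_prod_one_sub (hN : IsPoissonProcess P N ν)
    [IsProbabilityMeasure P] [SigmaFinite ν] {ι : Type*} {f g : E → ℝ≥0∞} (hf : Measurable f)
    (hg : Measurable g) (hfg : ∫⁻ x, g x * expNeg (f x) ∂ν ≠ ∞)
    {h : ι → E → ℝ≥0∞} (hh : ∀ i, Measurable (h i)) (S : Finset ι) :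
    ∫⁻ ω, (∫⁻ x, g x ∂(N ω)) * (expNeg (∫⁻ x, f x ∂(N ω)) *
        ∏ i ∈ S, (1 - expNeg (∫⁻ x, h i x ∂(N ω)))) ∂P =
      ∫⁻ x, g x * expNeg (f x) * ∫⁻ ω, expNeg (∫⁻ y, f y ∂(N ω)) *
        ∏ i ∈ S, (1 - expNeg (∫⁻ y, h i y ∂(N ω) + h i x)) ∂P ∂ν := by
  classical
  induction S using Finset.induction_on generalizing f with
  | empty =>
    simp only [Finset.prod_empty, mul_one]
    rw [hN.lintegral_mul_expNeg hf hg hfg, lintegral_mul_const _ (by fun_prop)]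
  | insert j S hj ih =>
    have hNg := hN.measurable_lintegral hg
    have hNf := hN.measurable_lintegral hf
    have hNh : ∀ i, Measurable fun ω => ∫⁻ x, h i x ∂(N ω) :=
      fun i => hN.measurable_lintegral (hh i)
    have hfj : Measurable fun x => f x + h j x := hf.add (hh j)
    have hle : ∫⁻ x, g x * expNeg (f x + h j x) ∂ν ≠ ∞ := by
      refine ne_top_of_le_ne_top hfg (lintegral_mono fun x => ?_)
      exact mul_le_mul_right (expNeg_antitone le_self_add) _
    have hfin : ∫⁻ ω, (∫⁻ x, g x ∂(N ω)) * (expNeg (∫⁻ x, (f x + h j x) ∂(N ω)) *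
        ∏ i ∈ S, (1 - expNeg (∫⁻ x, h i x ∂(N ω)))) ∂P ≠ ∞ := by
      have hNfj := hN.measurable_lintegral hfj
      refine ne_top_of_le_ne_top ?_ (lintegral_mono (g := fun ω => (∫⁻ x, g x ∂(N ω)) *
        expNeg (∫⁻ x, (f x + h j x) ∂(N ω))) fun ω => mul_le_mul_right
          (mul_le_of_le_one_right' (Finset.prod_le_one' fun i _ => tsub_le_self)) _)
      rw [hN.lintegral_mul_expNeg hfj hg hle, hN.lintegral_expNeg_lintegral hfj]
      exact ENNReal.mul_ne_top hle (expNeg_ne_top _)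
    -- Adding the finite expression for `f + h_j` and `S` to both sides turns the claim into the
    -- induction hypothesis for `f` and `S`.
    refine (ENNReal.add_left_inj hfin).1 ?_
    conv_rhs => rw [ih hfj hle]
    have hL : ∫⁻ ω, (∫⁻ x, g x ∂(N ω)) * (expNeg (∫⁻ x, f x ∂(N ω)) *
          ∏ i ∈ insert j S, (1 - expNeg (∫⁻ x, h i x ∂(N ω)))) ∂P +
        ∫⁻ ω, (∫⁻ x, g x ∂(N ω)) * (expNeg (∫⁻ x, (f x + h j x) ∂(N ω)) *
          ∏ i ∈ S, (1 - expNeg (∫⁻ x, h i x ∂(N ω)))) ∂P =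
        ∫⁻ ω, (∫⁻ x, g x ∂(N ω)) * (expNeg (∫⁻ x, f x ∂(N ω)) *
          ∏ i ∈ S, (1 - expNeg (∫⁻ x, h i x ∂(N ω)))) ∂P := by
      rw [← lintegral_add_left (by fun_prop)]
      refine lintegral_congr fun ω => ?_
      rw [Finset.prod_insert hj, lintegral_add_left hf, expNeg_add]
      generalize ∏ i ∈ S, (1 - expNeg (∫⁻ x, h i x ∂(N ω))) = Q
      calc _ = (∫⁻ x, g x ∂(N ω)) * (expNeg (∫⁻ x, f x ∂(N ω)) *
            (((1 - expNeg (∫⁻ x, h j x ∂(N ω))) + expNeg (∫⁻ x, h j x ∂(N ω))) * Q)) := by ring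
        _ = _ := by rw [tsub_add_cancel_of_le (expNeg_le_one _), one_mul]
    rw [hL, ih hf hfg]
    have hinner : ∀ T : Finset ι, Measurable fun x => ∫⁻ ω, expNeg (∫⁻ y, f y ∂(N ω)) *
        ∏ i ∈ T, (1 - expNeg (∫⁻ y, h i y ∂(N ω) + h i x)) ∂P := fun T => by
      refine Measurable.lintegral_prod_right'
        (f := fun z : E × Ω => expNeg (∫⁻ y, f y ∂(N z.2)) *
          ∏ i ∈ T, (1 - expNeg (∫⁻ y, h i y ∂(N z.2) + h i z.1))) ?_
      refine (measurable_expNeg.comp (hNf.comp measurable_snd)).mul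
        (Finset.measurable_fun_prod _ fun i _ => measurable_const.sub (measurable_expNeg.comp
          (((hNh i).comp measurable_snd).add ((hh i).comp measurable_fst))))
    have hinnerT := hinner (insert j S)
    rw [← lintegral_add_left (by fun_prop)]
    refine lintegral_congr fun x => ?_
    have hx : g x * expNeg (f x + h j x) * ∫⁻ ω, expNeg (∫⁻ y, (f y + h j y) ∂(N ω)) *
        ∏ i ∈ S, (1 - expNeg (∫⁻ y, h i y ∂(N ω) + h i x)) ∂P =
        g x * expNeg (f x) * ∫⁻ ω, expNeg (∫⁻ y, f y ∂(N ω)) *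
          (expNeg (∫⁻ y, h j y ∂(N ω) + h j x) *
            ∏ i ∈ S, (1 - expNeg (∫⁻ y, h i y ∂(N ω) + h i x))) ∂P := by
      have hNfj := hN.measurable_lintegral hfj
      rw [expNeg_add, ← mul_assoc, mul_assoc _ (expNeg (h j x)), ← lintegral_const_mul _
        (by fun_prop)]
      congr 1
      refine lintegral_congr fun ω => ?_
      rw [lintegral_add_left hf, expNeg_add, expNeg_add]
      ring
    rw [hx, ← mul_add, ← lintegral_add_left (by fun_prop)]
    congr 1
    refine lintegral_congr fun ω => ?_
    rw [Finset.prod_insert hj, ← mul_add, ← add_mul,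
      tsub_add_cancel_of_le (expNeg_le_one _), one_mul]

/-- The Mecke formula for the functional `N ↦ e^{-N f} ∏ N(g_i)`. -/
theorem lintegral_mul_expNeg_mul_prod (hN : IsPoissonProcess P N ν)
    [IsProbabilityMeasure P] [SigmaFinite ν] {ι : Type*} {f g : E → ℝ≥0∞} (hf : Measurable f)
    (hg : Measurable g) (hfg : ∫⁻ x, g x * expNeg (f x) ∂ν ≠ ∞)
    {h : ι → E → ℝ≥0∞} (hh : ∀ i, Measurable (h i)) (S : Finset ι) :
    ∫⁻ ω, (∫⁻ x, g x ∂(N ω)) * (expNeg (∫⁻ x, f x ∂(N ω)) *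
        ∏ i ∈ S, ∫⁻ x, h i x ∂(N ω)) ∂P =
      ∫⁻ x, g x * expNeg (f x) * ∫⁻ ω, expNeg (∫⁻ y, f y ∂(N ω)) *
        ∏ i ∈ S, (∫⁻ y, h i y ∂(N ω) + h i x) ∂P ∂ν := by
  have hNg := hN.measurable_lintegral hg
  have hNf := hN.measurable_lintegral hf
  have hNh : ∀ i, Measurable fun ω => ∫⁻ x, h i x ∂(N ω) :=
    fun i => hN.measurable_lintegral (hh i)
  have hL : Filter.Tendsto (fun k => ∫⁻ ω, (∫⁻ x, g x ∂(N ω)) * (expNeg (∫⁻ x, f x ∂(N ω)) *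
      ∏ i ∈ S, expSlope k (∫⁻ x, h i x ∂(N ω))) ∂P) Filter.atTop
      (nhds (∫⁻ ω, (∫⁻ x, g x ∂(N ω)) * (expNeg (∫⁻ x, f x ∂(N ω)) *
        ∏ i ∈ S, ∫⁻ x, h i x ∂(N ω)) ∂P)) := by
    refine tendsto_lintegral_of_le (fun k => by fun_prop) (fun k ω => ?_) (fun ω => ?_)
    · gcongr
      exact expSlope_le _ _
    · refine tendsto_mul_of_le (fun _ => le_rfl) (fun k => ?_) tendsto_const_nhds
        (tendsto_mul_of_le (fun _ => le_rfl) (fun k => ?_) tendsto_const_nhds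
          (tendsto_finset_prod_of_le S (fun i k => expSlope_le k _) fun i => tendsto_expSlope _))
      · gcongr
        exact expSlope_le _ _
      · gcongr
        exact expSlope_le _ _
  have hR : Filter.Tendsto (fun k => ∫⁻ x, g x * expNeg (f x) * ∫⁻ ω, expNeg (∫⁻ y, f y ∂(N ω)) *
        ∏ i ∈ S, expSlope k (∫⁻ y, h i y ∂(N ω) + h i x) ∂P ∂ν) Filter.atTop
      (nhds (∫⁻ x, g x * expNeg (f x) * ∫⁻ ω, expNeg (∫⁻ y, f y ∂(N ω)) *
        ∏ i ∈ S, (∫⁻ y, h i y ∂(N ω) + h i x) ∂P ∂ν)) := by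
    have hle : ∀ k x, ∫⁻ ω, expNeg (∫⁻ y, f y ∂(N ω)) *
        ∏ i ∈ S, expSlope k (∫⁻ y, h i y ∂(N ω) + h i x) ∂P ≤
        ∫⁻ ω, expNeg (∫⁻ y, f y ∂(N ω)) * ∏ i ∈ S, (∫⁻ y, h i y ∂(N ω) + h i x) ∂P := by
      intro k x
      refine lintegral_mono fun ω => ?_
      gcongr
      exact expSlope_le _ _
    refine tendsto_lintegral_of_le (fun k => ?_) (fun k x => ?_) (fun x => ?_)
    · refine (hg.mul (measurable_expNeg.comp hf)).mul (Measurable.lintegral_prod_right'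
        (f := fun z : E × Ω => expNeg (∫⁻ y, f y ∂(N z.2)) *
          ∏ i ∈ S, expSlope k (∫⁻ y, h i y ∂(N z.2) + h i z.1)) ?_)
      refine (measurable_expNeg.comp (hNf.comp measurable_snd)).mul
        (Finset.measurable_fun_prod _ fun i _ => (measurable_expSlope k).comp
          (((hNh i).comp measurable_snd).add ((hh i).comp measurable_fst)))
    · exact mul_le_mul_right (hle k x) _
    · refine tendsto_mul_of_le (fun _ => le_rfl) (fun k => hle k x) tendsto_const_nhds ?_
      refine tendsto_lintegral_of_le (fun k => by fun_prop) (fun k ω => ?_) (fun ω => ?_)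
      · gcongr
        exact expSlope_le _ _
      · refine tendsto_mul_of_le (fun _ => le_rfl) (fun k => ?_) tendsto_const_nhds
          (tendsto_finset_prod_of_le S (fun i k => expSlope_le k _) fun i => tendsto_expSlope _)
        gcongr
        exact expSlope_le _ _
  -- At each `k` this is the bounded version for `h_i / (k + 1)`, multiplied by `(k + 1) ^ |S|`.
  refine tendsto_nhds_unique hL (hR.congr fun k => ?_)
  have hk := hN.lintegral_mul_expNeg_mul_prod_one_sub hf hg hfg
    (h := fun i x => (k + 1 : ℝ≥0∞)⁻¹ * h i x) (fun i => (hh i).const_mul _) S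
  simp_rw [lintegral_const_mul _ (hh _), ← mul_add] at hk
  have hk2 := congrArg (fun t => (k + 1 : ℝ≥0∞) ^ S.card * t) hk
  have hkt : (k + 1 : ℝ≥0∞) ^ S.card ≠ ∞ := by finiteness
  rw [← lintegral_const_mul' _ _ hkt, ← lintegral_const_mul' _ _ hkt] at hk2
  rw [eq_comm]
  convert hk2 using 1
  · refine lintegral_congr fun ω => ?_
    simp only [expSlope, Finset.prod_mul_distrib, Finset.prod_const]
    ring
  · refine lintegral_congr fun x => ?_
    rw [mul_left_comm, ← lintegral_const_mul' _ _ hkt]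
    congr 1
    refine lintegral_congr fun ω => ?_
    simp only [expSlope, Finset.prod_mul_distrib, Finset.prod_const]
    ring

/-- The recursion for the moments `E[e^{-N f} ∏ N(g_i)]` obtained by removing one factor. -/
theorem lintegral_expNeg_mul_prod_insert (hN : IsPoissonProcess P N ν)
    [IsProbabilityMeasure P] [SigmaFinite ν] {ι : Type*} [DecidableEq ι] {f : E → ℝ≥0∞}
    (hf : Measurable f) {g : ι → E → ℝ≥0∞} (hg : ∀ i, Measurable (g i)) {j : ι}
    {S : Finset ι} (hj : j ∉ S) (hfg : ∫⁻ x, g j x * expNeg (f x) ∂ν ≠ ∞) :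
    ∫⁻ ω, expNeg (∫⁻ x, f x ∂(N ω)) * ∏ i ∈ insert j S, ∫⁻ x, g i x ∂(N ω) ∂P =
      ∑ R ∈ S.powerset, (∫⁻ x, expNeg (f x) * ∏ i ∈ insert j R, g i x ∂ν) *
        ∫⁻ ω, expNeg (∫⁻ x, f x ∂(N ω)) * ∏ i ∈ S \ R, ∫⁻ x, g i x ∂(N ω) ∂P := by
  have hNf := hN.measurable_lintegral hf
  have hNg : ∀ i, Measurable fun ω => ∫⁻ x, g i x ∂(N ω) :=
    fun i => hN.measurable_lintegral (hg i)
  have h1 := hN.lintegral_mul_expNeg_mul_prod hf (hg j) hfg hg S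
  have h2 : ∀ ω, expNeg (∫⁻ x, f x ∂(N ω)) * ∏ i ∈ insert j S, ∫⁻ x, g i x ∂(N ω) =
      (∫⁻ x, g j x ∂(N ω)) * (expNeg (∫⁻ x, f x ∂(N ω)) * ∏ i ∈ S, ∫⁻ x, g i x ∂(N ω)) := by
    intro ω
    rw [Finset.prod_insert hj]
    ring
  simp_rw [h2]
  rw [h1]
  have h3 : ∀ R ∈ S.powerset, (∫⁻ x, expNeg (f x) * ∏ i ∈ insert j R, g i x ∂ν) *
        ∫⁻ ω, expNeg (∫⁻ x, f x ∂(N ω)) * ∏ i ∈ S \ R, ∫⁻ x, g i x ∂(N ω) ∂P =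
      ∫⁻ x, g j x * expNeg (f x) * ((∏ i ∈ R, g i x) *
        ∫⁻ ω, expNeg (∫⁻ x, f x ∂(N ω)) * ∏ i ∈ S \ R, ∫⁻ x, g i x ∂(N ω) ∂P) ∂ν := by
    intro R hR
    have hjR : j ∉ R := fun h => hj (Finset.mem_powerset.1 hR h)
    rw [← lintegral_mul_const _ (by fun_prop)]
    refine lintegral_congr fun x => ?_
    rw [Finset.prod_insert hjR]
    ring
  rw [Finset.sum_congr rfl h3, ← lintegral_finsetSum _ (fun R _ => by fun_prop)]
  refine lintegral_congr fun x => ?_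
  rw [← Finset.mul_sum]
  congr 1
  -- Here `R` is the set of indices whose factor is evaluated at the added point `x`; with `j` it
  -- forms one cell.
  simp_rw [add_comm (∫⁻ y, _ ∂(N _)), Finset.prod_add, Finset.mul_sum]
  rw [lintegral_finsetSum _ (fun R _ => by fun_prop)]
  refine Finset.sum_congr rfl fun R _ => ?_
  rw [← lintegral_const_mul _ (by fun_prop)]
  refine lintegral_congr fun ω => ?_
  ring

end IsPoissonProcess
end TiltedCRM

namespace TiltedCRM

/-! ### Sums over the partitions of a finite set -/

/-- A partition is determined by the cell `insert j T` of `j` and a partition of the remaining set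
`S \ T`. -/
theorem sum_finpartition_insert {ι R : Type*} [DecidableEq ι] [CommSemiring R]
    (w : Finset ι → R) {j : ι} {S : Finset ι} (hj : j ∉ S) :
    ∑ p : Finpartition (insert j S), ∏ c ∈ p.parts, w c =
      ∑ T ∈ S.powerset, w (insert j T) * ∑ p : Finpartition (S \ T), ∏ c ∈ p.parts, w c := by
  simp_rw [Finset.mul_sum]
  rw [Finset.sum_sigma']
  symm
  have hdisj : ∀ T, Disjoint (S \ T) (insert j T) := fun T => by
    rw [Finset.disjoint_insert_right]
    exact ⟨fun h => hj (Finset.mem_sdiff.1 h).1, Finset.sdiff_disjoint⟩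
  have hunion : ∀ T ∈ S.powerset, (S \ T) ⊔ insert j T = insert j S := fun T hT => by
    rw [Finset.sup_eq_union, Finset.union_insert, Finset.sdiff_union_of_subset
      (Finset.mem_powerset.1 hT)]
  refine Finset.sum_bij (fun x hx => x.2.extend (Finset.insert_nonempty j x.1).ne_empty
      (hdisj x.1) (hunion x.1 (Finset.mem_sigma.1 hx).1)) (fun _ _ => Finset.mem_univ _)
      ?_ ?_ ?_
  · rintro ⟨T, p⟩ h1 ⟨T', p'⟩ h2 h
    have hjp : ∀ (T : Finset ι) (p : Finpartition (S \ T)), ∀ c ∈ p.parts, j ∉ c :=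
      fun T p c hc hjc => hj (Finset.mem_sdiff.1 (p.le hc hjc)).1
    have hparts : insert (insert j T) p.parts = insert (insert j T') p'.parts :=
      congrArg Finpartition.parts h
    have hjT : j ∉ T := fun h => hj (Finset.mem_powerset.1 (Finset.mem_sigma.1 h1).1 h)
    have hjT' : j ∉ T' := fun h => hj (Finset.mem_powerset.1 (Finset.mem_sigma.1 h2).1 h)
    have hTT : insert j T = insert j T' := by
      have : insert j T ∈ insert (insert j T') p'.parts := hparts ▸ Finset.mem_insert_self _ _
      rcases Finset.mem_insert.1 this with h | h
      · exact h
      · exact absurd (Finset.mem_insert_self j T) (hjp _ _ _ h)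
    obtain rfl : T = T' := by
      rw [← Finset.erase_insert hjT, hTT, Finset.erase_insert hjT']
    have hpp : p.parts = p'.parts := by
      rw [← Finset.erase_insert (fun h => hjp _ p _ h (Finset.mem_insert_self j T)), hparts,
        Finset.erase_insert (fun h => hjp _ p' _ h (Finset.mem_insert_self j T))]
    rw [Finpartition.ext hpp]
  · intro p _
    have hjm : j ∈ p.part j := p.mem_part_self.2 (Finset.mem_insert_self j S)
    have hmem : p.part j ∈ p.parts := p.part_mem.2 (Finset.mem_insert_self j S)
    have hT : (p.part j).erase j ⊆ S := by
      rw [← Finset.subset_insert_iff]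
      exact p.le hmem
    have hins : insert j ((p.part j).erase j) = p.part j := Finset.insert_erase hjm
    have hsd : S \ (p.part j).erase j = insert j S \ p.part j := by
      ext i
      simp only [Finset.mem_sdiff, Finset.mem_erase, Finset.mem_insert, not_and]
      grind
    refine ⟨⟨(p.part j).erase j, (p.avoid (p.part j)).copy hsd.symm⟩,
      Finset.mem_sigma.2 ⟨Finset.mem_powerset.2 hT, Finset.mem_univ _⟩, ?_⟩
    refine Finpartition.ext ?_
    change insert (insert j ((p.part j).erase j)) (p.avoid (p.part j)).parts = p.parts
    rw [hins]
    ext c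
    have hd : ∀ d ∈ p.parts, d ≠ p.part j → Disjoint d (p.part j) :=
      fun d hd hne => p.disjoint hd hmem hne
    simp only [Finset.mem_insert, Finpartition.mem_avoid]
    constructor
    · rintro (rfl | ⟨d, hdp, hdle, rfl⟩)
      · exact hmem
      · have hne : d ≠ p.part j := fun h => hdle (h ▸ le_rfl)
        rwa [(hd d hdp hne).sdiff_eq_left]
    · intro hc
      by_cases hcj : c = p.part j
      · exact Or.inl hcj
      · refine Or.inr ⟨c, hc, fun hle => p.ne_bot hc ?_, (hd c hc hcj).sdiff_eq_left⟩
        exact (hd c hc hcj).eq_bot_of_le hle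
  · rintro ⟨T, p⟩ h1
    have hnot : insert j T ∉ p.parts := fun h =>
      hj (Finset.mem_sdiff.1 (p.le h (Finset.mem_insert_self j T))).1
    change w (insert j T) * ∏ c ∈ p.parts, w c = ∏ c ∈ insert (insert j T) p.parts, w c
    rw [Finset.prod_insert hnot]

variable {Ω E : Type*} [MeasurableSpace Ω] [MeasurableSpace E] {P : Measure Ω}
  {N : Ω → Measure E} {ν : Measure E}

/-- The moments `E[e^{-N f} ∏ N(g_i)]` of a Poisson process as a sum over partitions. -/
theorem IsPoissonProcess.lintegral_expNeg_mul_prod (hN : IsPoissonProcess P N ν)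
    [IsProbabilityMeasure P] [SigmaFinite ν] {ι : Type*} [DecidableEq ι] {f : E → ℝ≥0∞}
    (hf : Measurable f) {g : ι → E → ℝ≥0∞} (hg : ∀ i, Measurable (g i))
    (hfg : ∀ i, ∫⁻ x, g i x * expNeg (f x) ∂ν ≠ ∞) (S : Finset ι) :
    ∫⁻ ω, expNeg (∫⁻ x, f x ∂(N ω)) * ∏ i ∈ S, ∫⁻ x, g i x ∂(N ω) ∂P =
      expNeg (∫⁻ x, (1 - expNeg (f x)) ∂ν) * ∑ p : Finpartition S, ∏ c ∈ p.parts,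
        ∫⁻ x, expNeg (f x) * ∏ i ∈ c, g i x ∂ν := by
  -- Strong induction, because removing the cell of `j` can remove several indices at once.
  induction S using Finset.strongInduction with
  | H S ih =>
    rcases S.eq_empty_or_nonempty with rfl | ⟨j, hjS⟩
    · have : Unique (Finpartition (∅ : Finset ι)) :=
        inferInstanceAs (Unique (Finpartition (⊥ : Finset ι)))
      have hparts : ∀ p : Finpartition (∅ : Finset ι), p.parts = ∅ :=
        fun p => p.parts_eq_empty_iff.2 rfl
      simp [hparts, hN.lintegral_expNeg_lintegral hf]
    · obtain ⟨T, hjT, rfl⟩ : ∃ T, j ∉ T ∧ insert j T = S :=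
        ⟨S.erase j, Finset.notMem_erase j S, Finset.insert_erase hjS⟩
      rw [hN.lintegral_expNeg_mul_prod_insert hf hg hjT (hfg j), sum_finpartition_insert _ hjT,
        Finset.mul_sum]
      refine Finset.sum_congr rfl fun R hR => ?_
      rw [ih (T \ R) (lt_of_le_of_lt Finset.sdiff_subset (Finset.ssubset_insert hjT))]
      ring

end TiltedCRM

namespace TiltedCRM

variable {𝕏 : Type*} [MeasurableSpace 𝕏]

/-! ### The intensity measure -/

theorem ae_jump_pos {ρ : Kernel 𝕏 ℝ} (hρ : ∀ x, ρ x (Set.Iic 0) = 0) (x : 𝕏) : ∀ᵐ s ∂(ρ x), 0 < s := by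
  refine (measure_eq_zero_iff_ae_notMem.1 (hρ x)).mono fun s hs => ?_
  simpa using hs

theorem tau_eq {ρ : Kernel 𝕏 ℝ} (hρ : ∀ x, ρ x (Set.Iic 0) = 0) (m : ℕ) (x : 𝕏) {a : ℝ} (ha : 0 ≤ a) :
    tau ρ m x a =
      ∫⁻ s, ENNReal.ofReal s ^ m * expNeg (ENNReal.ofReal a * ENNReal.ofReal s) ∂(ρ x) := by
  refine lintegral_congr_ae ?_
  filter_upwards [ae_jump_pos hρ x] with s hs
  rw [← ENNReal.ofReal_mul ha, expNeg_ofReal (by positivity), ← ENNReal.ofReal_pow hs.le,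
    ← ENNReal.ofReal_mul (by positivity), mul_comm s a]

section Intensity

variable {η : Measure 𝕏} [SFinite η] {ρ : Kernel 𝕏 ℝ} [IsSFiniteKernel ρ]

theorem lintegral_intensity {f : 𝕏 × ℝ → ℝ≥0∞} (hf : Measurable f) :
    ∫⁻ z, f z ∂(intensity η ρ) = ∫⁻ x, ∫⁻ s, f (x, s) ∂(ρ x) ∂η :=
  Measure.lintegral_compProd hf

theorem ae_intensity_pos (hρ : ∀ x, ρ x (Set.Iic 0) = 0) :
    ∀ᵐ z ∂(intensity η ρ), 0 < z.2 := by
  unfold intensity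
  rw [Measure.ae_compProd_iff (measurableSet_lt measurable_const measurable_snd)]
  exact Filter.Eventually.of_forall (ae_jump_pos hρ)

/-- Markov's inequality for `min s 1` makes the sets of jumps bounded away from `0` finite;
nonpositive jumps form a null set. -/
theorem sigmaFinite_intensity (hρ : ∀ x, ρ x (Set.Iic 0) = 0)
    (hν_fin : ∀ s : ℝ, 0 < s → ∫⁻ z, ENNReal.ofReal (min z.2 s) ∂(intensity η ρ) < ∞) :
    SigmaFinite (intensity η ρ) := by
  have hae := ae_intensity_pos (η := η) hρ
  refine ⟨⟨⟨fun k => {z | 1 / ((k : ℝ) + 1) ≤ min z.2 1} ∪ {z | z.2 ≤ 0}, fun _ => trivial,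
    fun k => ?_, ?_⟩⟩⟩
  · refine (measure_union_le _ _).trans_lt (ENNReal.add_lt_top.2 ⟨?_, ?_⟩)
    · have hpos : (0 : ℝ) < 1 / ((k : ℝ) + 1) := by positivity
      refine lt_of_le_of_lt ((measure_mono fun z hz => ?_).trans
        (meas_ge_le_lintegral_div (f := fun z : 𝕏 × ℝ => ENNReal.ofReal (min z.2 1))
          (by fun_prop) (ENNReal.ofReal_pos.2 hpos).ne' ENNReal.ofReal_ne_top))
        (ENNReal.div_lt_top (hν_fin 1 one_pos).ne (ENNReal.ofReal_pos.2 hpos).ne')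
      exact ENNReal.ofReal_le_ofReal hz
    · have : intensity η ρ {z | z.2 ≤ 0} = 0 := by
        rw [measure_eq_zero_iff_ae_notMem]
        exact hae.mono fun z hz => by simpa using hz
      rw [this]
      exact ENNReal.zero_lt_top
  · refine Set.eq_univ_of_forall fun z => ?_
    rcases le_or_gt z.2 0 with hz | hz
    · exact Set.mem_iUnion.2 ⟨0, Or.inr hz⟩
    · obtain ⟨k, hk⟩ := exists_nat_one_div_lt (lt_min hz one_pos)
      exact Set.mem_iUnion.2 ⟨k, Or.inl hk.le⟩

theorem psi_zero_eq (hρ : ∀ x, ρ x (Set.Iic 0) = 0) {a : ℝ} (ha : 0 ≤ a) :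
    psi η ρ 0 a =
      ∫⁻ z, (1 - expNeg (ENNReal.ofReal a * ENNReal.ofReal z.2)) ∂(intensity η ρ) := by
  rw [lintegral_intensity (by fun_prop), psi]
  refine lintegral_congr fun x => lintegral_congr_ae ?_
  filter_upwards [ae_jump_pos hρ x] with s hs
  rw [← ENNReal.ofReal_mul ha, expNeg_ofReal (by positivity), ← ENNReal.ofReal_one,
    ← ENNReal.ofReal_sub _ (Real.exp_pos _).le]
  simp

theorem psi_zero_lt_top (hρ : ∀ x, ρ x (Set.Iic 0) = 0)
    (hν_fin : ∀ s : ℝ, 0 < s → ∫⁻ z, ENNReal.ofReal (min z.2 s) ∂(intensity η ρ) < ∞)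
    {a : ℝ} (ha : 0 < a) : psi η ρ 0 a < ∞ := by
  rw [psi_zero_eq hρ ha.le]
  have hle : ∫⁻ z, (1 - expNeg (ENNReal.ofReal a * ENNReal.ofReal z.2)) ∂(intensity η ρ) ≤
      ∫⁻ z, ENNReal.ofReal a * ENNReal.ofReal (min z.2 a⁻¹) ∂(intensity η ρ) := by
    refine lintegral_mono fun z => ?_
    rw [← ENNReal.ofReal_mul ha.le, ← ENNReal.ofReal_mul ha.le, mul_min_of_nonneg _ _ ha.le,
      mul_inv_cancel₀ ha.ne', ENNReal.ofReal_min, ENNReal.ofReal_one]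
    exact le_min (one_sub_expNeg_le _) tsub_le_self
  refine hle.trans_lt ?_
  rw [lintegral_const_mul _ (by fun_prop)]
  exact ENNReal.mul_lt_top ENNReal.ofReal_lt_top (hν_fin _ (inv_pos.2 ha))

theorem measurable_tau (m : ℕ) : Measurable fun z : 𝕏 × ℝ => tau ρ m z.1 z.2 := by
  unfold tau
  have h : Measurable fun w : (𝕏 × ℝ) × ℝ =>
      ENNReal.ofReal (w.2 ^ m * Real.exp (-(w.2 * w.1.2))) := by fun_prop
  exact Measurable.lintegral_kernel_prod_right' (κ := ρ.comap Prod.fst measurable_fst) h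

theorem measurable_tau_left (m : ℕ) (a : ℝ) : Measurable fun x : 𝕏 => tau ρ m x a :=
  (measurable_tau m).comp (measurable_id.prodMk measurable_const)

theorem measurable_kappa (m : ℕ) : Measurable fun a : ℝ => kappa η ρ m a :=
  Measurable.lintegral_prod_left' (measurable_tau m)

theorem measurable_psi_zero : Measurable fun a : ℝ => psi η ρ 0 a := by
  unfold psi
  have h : Measurable fun w : (𝕏 × ℝ) × ℝ =>
      ENNReal.ofReal ((1 - Real.exp (-(w.1.2 * w.2))) * Real.exp (-(0 * w.2))) := by fun_prop
  exact Measurable.lintegral_prod_left' (f := fun w : 𝕏 × ℝ => ∫⁻ s, ENNReal.ofReal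
    ((1 - Real.exp (-(w.2 * s))) * Real.exp (-(0 * s))) ∂(ρ w.1))
    (Measurable.lintegral_kernel_prod_right' (κ := ρ.comap Prod.fst measurable_fst) h)

theorem kappa_eq (hρ : ∀ x, ρ x (Set.Iic 0) = 0) (m : ℕ) {a : ℝ} (ha : 0 ≤ a) :
    kappa η ρ m a = ∫⁻ z, ENNReal.ofReal z.2 ^ m *
      expNeg (ENNReal.ofReal a * ENNReal.ofReal z.2) ∂(intensity η ρ) := by
  rw [lintegral_intensity (by fun_prop), kappa]
  exact lintegral_congr fun x => tau_eq hρ m x ha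

theorem kappa_lt_top
    (hν_fin : ∀ s : ℝ, 0 < s → ∫⁻ z, ENNReal.ofReal (min z.2 s) ∂(intensity η ρ) < ∞)
    (hρ : ∀ x, ρ x (Set.Iic 0) = 0) {m : ℕ} (hm : 1 ≤ m) {a : ℝ} (ha : 0 < a) :
    kappa η ρ m a < ∞ := by
  -- Chosen so that `s^m e^{-sa} ≤ c min(s, 1)`: for `s ≤ 1` the left side is at most `s`, as `m ≥
  -- 1`; for `s ≥ 1` use `(sa)^m / m! ≤ e^{sa}`.
  set c : ℝ := 1 + (m.factorial : ℝ) / a ^ m with hc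
  have hc1 : 1 ≤ c := le_add_of_nonneg_right (by positivity)
  have hle : kappa η ρ m a ≤
      ∫⁻ z, ENNReal.ofReal c * ENNReal.ofReal (min z.2 1) ∂(intensity η ρ) := by
    rw [lintegral_intensity (by fun_prop), kappa]
    refine lintegral_mono fun x => lintegral_mono_ae ?_
    filter_upwards [ae_jump_pos hρ x] with s hs
    rw [← ENNReal.ofReal_mul (by positivity)]
    refine ENNReal.ofReal_le_ofReal ?_
    rcases le_total s 1 with h1 | h1
    · rw [min_eq_left h1]
      calc s ^ m * Real.exp (-(s * a)) ≤ s ^ 1 * 1 := by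
            refine mul_le_mul (pow_le_pow_of_le_one hs.le h1 hm) ?_ (Real.exp_pos _).le
              (by positivity)
            rw [Real.exp_le_one_iff]
            have := mul_pos hs ha
            linarith
        _ ≤ c * s := by rw [pow_one, mul_one]; exact le_mul_of_one_le_left hs.le hc1
    · rw [min_eq_right h1, mul_one]
      have h2 := Real.pow_div_factorial_le_exp (s * a) (by positivity) m
      have h3 : s ^ m ≤ (m.factorial : ℝ) / a ^ m * Real.exp (s * a) := by
        rw [mul_pow, div_le_iff₀ (by positivity)] at h2
        rw [div_mul_eq_mul_div, le_div_iff₀ (by positivity)]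
        linarith
      calc s ^ m * Real.exp (-(s * a))
          ≤ (m.factorial : ℝ) / a ^ m * Real.exp (s * a) * Real.exp (-(s * a)) := by gcongr
        _ = (m.factorial : ℝ) / a ^ m := by
            rw [mul_assoc, ← Real.exp_add, add_neg_cancel, Real.exp_zero, mul_one]
        _ ≤ c := by rw [hc]; linarith
  refine hle.trans_lt ?_
  rw [lintegral_const_mul _ (by fun_prop)]
  exact ENNReal.mul_lt_top ENNReal.ofReal_lt_top (hν_fin 1 one_pos)

theorem kappa_pos (hρ : ∀ x, ρ x (Set.Iic 0) = 0) (hν : intensity η ρ ≠ 0) (m : ℕ) {a : ℝ}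
    (ha : 0 ≤ a) : 0 < kappa η ρ m a := by
  rw [kappa_eq hρ m ha, pos_iff_ne_zero]
  intro h0
  rw [lintegral_eq_zero_iff (by fun_prop)] at h0
  have : ∀ᵐ z ∂(intensity η ρ), False := by
    filter_upwards [h0, ae_intensity_pos (η := η) hρ] with z h1 h2
    refine (ENNReal.mul_pos (pow_ne_zero m (ENNReal.ofReal_pos.2 h2).ne')
      (expNeg_pos (by finiteness)).ne').ne' h1
  exact hν (ae_eq_bot.1 (Filter.eventually_false_iff_eq_bot.1 this))

end Intensity

/-! ### The completely random measure -/

theorem jumpMeasure_apply (m : Measure (𝕏 × ℝ)) {B : Set 𝕏} (hB : MeasurableSet B) :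
    jumpMeasure m B = ∫⁻ z, B.indicator 1 z.1 * ENNReal.ofReal z.2 ∂m := by
  rw [jumpMeasure, Measure.map_apply measurable_fst hB, withDensity_apply _ (measurable_fst hB),
    ← lintegral_indicator (measurable_fst hB)]
  refine lintegral_congr fun z => ?_
  by_cases hz : z.1 ∈ B <;> simp [Set.indicator, hz]

theorem jumpMeasure_univ (m : Measure (𝕏 × ℝ)) :
    jumpMeasure m Set.univ = ∫⁻ z, ENNReal.ofReal z.2 ∂m := by
  simp [jumpMeasure_apply]

theorem measurable_indicator_mul_jump {B : Set 𝕏} (hB : MeasurableSet B) :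
    Measurable fun z : 𝕏 × ℝ => B.indicator (1 : 𝕏 → ℝ≥0∞) z.1 * ENNReal.ofReal z.2 :=
  ((measurable_one.indicator hB).comp measurable_fst).mul
    (ENNReal.measurable_ofReal.comp measurable_snd)

theorem measurable_jumpMeasure : Measurable (jumpMeasure : Measure (𝕏 × ℝ) → Measure 𝕏) := by
  refine Measure.measurable_of_measurable_coe _ fun B hB => ?_
  simp_rw [jumpMeasure_apply _ hB]
  exact Measure.measurable_lintegral (measurable_indicator_mul_jump hB)

theorem measurable_jumpMeasure_univ {Ω : Type*} [MeasurableSpace Ω] {P : Measure Ω}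
    {N : Ω → Measure (𝕏 × ℝ)} {ν : Measure (𝕏 × ℝ)} (hN : IsPoissonProcess P N ν) :
    Measurable fun ω => jumpMeasure (N ω) Set.univ :=
  (Measure.measurable_coe MeasurableSet.univ).comp (measurable_jumpMeasure.comp hN.measurable)

section CRM

variable {η : Measure 𝕏} [SFinite η] {ρ : Kernel 𝕏 ℝ} [IsSFiniteKernel ρ]
  {Ω : Type*} [MeasurableSpace Ω] {P : Measure Ω} [IsProbabilityMeasure P]
  {N : Ω → Measure (𝕏 × ℝ)}

/-- The joint moments of the values of the completely random measure, tilted by `e^{-a T}`. -/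
theorem lintegral_expNeg_mul_prod_jumpMeasure (hρ : ∀ x, ρ x (Set.Iic 0) = 0)
    (hν_fin : ∀ s : ℝ, 0 < s → ∫⁻ z, ENNReal.ofReal (min z.2 s) ∂(intensity η ρ) < ∞)
    (hN : IsPoissonProcess P N (intensity η ρ)) {a : ℝ} (ha : 0 < a) {n : ℕ}
    {B : Fin n → Set 𝕏} (hB : ∀ i, MeasurableSet (B i)) :
    ∫⁻ ω, expNeg (ENNReal.ofReal a * jumpMeasure (N ω) Set.univ) *
        ∏ i, jumpMeasure (N ω) (B i) ∂P =
      expNeg (psi η ρ 0 a) * ∑ p : IndexPartition n, ∏ c ∈ p.parts,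
        ∫⁻ x, (∏ i ∈ c, (B i).indicator 1 x) * tau ρ c.card x a ∂η := by
  have := sigmaFinite_intensity (η := η) hρ hν_fin
  have hg := fun i => measurable_indicator_mul_jump (hB i)
  have h := hN.lintegral_expNeg_mul_prod
    (f := fun z => ENNReal.ofReal a * ENNReal.ofReal z.2) (by fun_prop) hg
    -- The required finiteness is that of `κ_1(a)`, which dominates after dropping the indicator.
    (fun i => by
      refine ne_top_of_le_ne_top (kappa_lt_top (η := η) hν_fin hρ le_rfl ha).ne ?_
      rw [kappa_eq hρ 1 ha.le]
      refine lintegral_mono fun z => ?_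
      rw [pow_one]
      gcongr
      refine mul_le_of_le_one_left' ?_
      exact Set.indicator_le_self' (fun _ _ => zero_le) z.1) Finset.univ
  rw [← psi_zero_eq hρ ha.le] at h
  convert h using 1
  · refine lintegral_congr fun ω => ?_
    rw [lintegral_const_mul _ (by fun_prop), jumpMeasure_univ]
    simp_rw [jumpMeasure_apply _ (hB _)]
  · congr 1
    refine Finset.sum_congr rfl fun p _ => Finset.prod_congr rfl fun c _ => ?_
    rw [lintegral_intensity (by fun_prop)]
    refine lintegral_congr fun x => ?_
    rw [tau_eq hρ _ x ha.le, ← lintegral_const_mul _ (by fun_prop)]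
    refine lintegral_congr fun s => ?_
    rw [Finset.prod_mul_distrib, Finset.prod_const]
    ring

theorem lintegral_expNeg_jumpMeasure_univ (hρ : ∀ x, ρ x (Set.Iic 0) = 0)
    (hν_fin : ∀ s : ℝ, 0 < s → ∫⁻ z, ENNReal.ofReal (min z.2 s) ∂(intensity η ρ) < ∞)
    (hN : IsPoissonProcess P N (intensity η ρ)) (a : ℝ) :
    ∫⁻ ω, expNeg (ENNReal.ofReal a * jumpMeasure (N ω) Set.univ) ∂P =
      expNeg (∫⁻ z, (1 - expNeg (ENNReal.ofReal a * ENNReal.ofReal z.2)) ∂(intensity η ρ)) := by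
  have := sigmaFinite_intensity (η := η) hρ hν_fin
  rw [← hN.lintegral_expNeg_lintegral (by fun_prop)]
  refine lintegral_congr fun ω => ?_
  rw [lintegral_const_mul _ (by fun_prop), jumpMeasure_univ]

/-- For `a > 0`, `E[e^{-aT}] ≤ P(T < ∞)`. As `a` tends to `0` the Laplace exponent tends to `0`,
dominated by its integrand at `a = 1`. -/
theorem ae_jumpMeasure_univ_ne_top (hρ : ∀ x, ρ x (Set.Iic 0) = 0)
    (hν_fin : ∀ s : ℝ, 0 < s → ∫⁻ z, ENNReal.ofReal (min z.2 s) ∂(intensity η ρ) < ∞)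
    (hN : IsPoissonProcess P N (intensity η ρ)) :
    ∀ᵐ ω ∂P, jumpMeasure (N ω) Set.univ ≠ ∞ := by
  have hT := measurable_jumpMeasure_univ hN
  have hs : MeasurableSet {ω | jumpMeasure (N ω) Set.univ ≠ ∞} :=
    hT (measurableSet_singleton ∞).compl
  have hle : ∀ k : ℕ, expNeg (∫⁻ z, (1 - expNeg (ENNReal.ofReal (1 / ((k : ℝ) + 1)) *
      ENNReal.ofReal z.2)) ∂(intensity η ρ)) ≤ P {ω | jumpMeasure (N ω) Set.univ ≠ ∞} := by
    intro k
    have hk : (0 : ℝ) < 1 / ((k : ℝ) + 1) := by positivity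
    rw [← lintegral_expNeg_jumpMeasure_univ hρ hν_fin hN, ← lintegral_indicator_one hs]
    refine lintegral_mono fun ω => ?_
    by_cases hω : jumpMeasure (N ω) Set.univ = ∞
    · rw [hω, ENNReal.mul_top (ENNReal.ofReal_pos.2 hk).ne', expNeg_top]
      exact zero_le
    · rw [Set.indicator_of_mem (by exact hω)]
      exact expNeg_le_one _
  have hlim0 : Filter.Tendsto (fun k : ℕ => ENNReal.ofReal (1 / ((k : ℝ) + 1))) Filter.atTop
      (nhds 0) := by
    simpa using ENNReal.tendsto_ofReal tendsto_one_div_add_atTop_nhds_zero_nat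
  have hlim : Filter.Tendsto (fun k : ℕ => ∫⁻ z, (1 - expNeg (ENNReal.ofReal
      (1 / ((k : ℝ) + 1)) * ENNReal.ofReal z.2)) ∂(intensity η ρ)) Filter.atTop
      (nhds (∫⁻ z, 0 ∂(intensity η ρ))) := by
    refine tendsto_lintegral_of_dominated_convergence
      (fun z => 1 - expNeg (ENNReal.ofReal 1 * ENNReal.ofReal z.2)) (fun k => by fun_prop)
      (fun k => Filter.Eventually.of_forall fun z => ?_) ?_
      (Filter.Eventually.of_forall fun z => ?_)
    · refine tsub_le_tsub_left (expNeg_antitone ?_) 1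
      gcongr
      rw [div_le_one (by positivity)]
      linarith [Nat.cast_nonneg (α := ℝ) k]
    · rw [← psi_zero_eq hρ zero_le_one]
      exact (psi_zero_lt_top hρ hν_fin one_pos).ne
    · have h1 : Filter.Tendsto (fun k : ℕ => ENNReal.ofReal (1 / ((k : ℝ) + 1)) *
          ENNReal.ofReal z.2) Filter.atTop (nhds (0 * ENNReal.ofReal z.2)) :=
        ENNReal.Tendsto.mul_const hlim0 (Or.inr ENNReal.ofReal_ne_top)
      rw [zero_mul] at h1
      have h2 := ENNReal.Tendsto.sub (tendsto_const_nhds (x := (1 : ℝ≥0∞)))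
        ((continuous_expNeg.tendsto 0).comp h1) (Or.inl ENNReal.one_ne_top)
      simpa using h2
  have h1 : (1 : ℝ≥0∞) ≤ P {ω | jumpMeasure (N ω) Set.univ ≠ ∞} := by
    refine le_of_tendsto' (x := Filter.atTop) ?_ hle
    simpa [Function.comp_def] using (continuous_expNeg.tendsto _).comp hlim
  exact (prob_compl_eq_zero_iff hs).2 (le_antisymm prob_le_one h1)

/-- `P(T = 0) ≤ E[e^{-kT}]`, and the Laplace exponent increases to the total intensity, which is
infinite. -/
theorem ae_jumpMeasure_univ_ne_zero (hρ : ∀ x, ρ x (Set.Iic 0) = 0)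
    (hν_fin : ∀ s : ℝ, 0 < s → ∫⁻ z, ENNReal.ofReal (min z.2 s) ∂(intensity η ρ) < ∞)
    (hν_inf : intensity η ρ Set.univ = ∞) (hN : IsPoissonProcess P N (intensity η ρ)) :
    ∀ᵐ ω ∂P, jumpMeasure (N ω) Set.univ ≠ 0 := by
  have hT := measurable_jumpMeasure_univ hN
  have hs : MeasurableSet {ω | jumpMeasure (N ω) Set.univ = 0} :=
    hT (measurableSet_singleton 0)
  have hle : ∀ k : ℕ, P {ω | jumpMeasure (N ω) Set.univ = 0} ≤
      expNeg (∫⁻ z, (1 - expNeg (ENNReal.ofReal k * ENNReal.ofReal z.2)) ∂(intensity η ρ)) := by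
    intro k
    rw [← lintegral_expNeg_jumpMeasure_univ hρ hν_fin hN,
      ← lintegral_indicator_one hs]
    refine lintegral_mono fun ω => ?_
    by_cases hω : jumpMeasure (N ω) Set.univ = 0
    · rw [hω, mul_zero, expNeg_zero]
      exact Set.indicator_le_self' (fun _ _ => zero_le) ω
    · rw [Set.indicator_of_notMem (by exact hω)]
      exact zero_le
  have hlim : Filter.Tendsto (fun k : ℕ => ∫⁻ z, (1 - expNeg (ENNReal.ofReal k *
      ENNReal.ofReal z.2)) ∂(intensity η ρ)) Filter.atTop
      (nhds (∫⁻ z, 1 ∂(intensity η ρ))) := by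
    refine lintegral_tendsto_of_tendsto_of_monotone (fun k => by fun_prop)
      (Filter.Eventually.of_forall fun z k l hkl => ?_) ?_
    · refine tsub_le_tsub_left (expNeg_antitone ?_) 1
      gcongr
    · filter_upwards [ae_intensity_pos (η := η) hρ] with z hz
      have h1 : Filter.Tendsto (fun k : ℕ => ENNReal.ofReal k * ENNReal.ofReal z.2) Filter.atTop
          (nhds (∞ * ENNReal.ofReal z.2)) := by
        simp_rw [ENNReal.ofReal_natCast]
        exact ENNReal.Tendsto.mul_const ENNReal.tendsto_nat_nhds_top
          (Or.inl ENNReal.top_ne_zero)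
      rw [ENNReal.top_mul (ENNReal.ofReal_pos.2 hz).ne'] at h1
      have h2 := ENNReal.Tendsto.sub (tendsto_const_nhds (x := (1 : ℝ≥0∞)))
        ((continuous_expNeg.tendsto ∞).comp h1) (Or.inl ENNReal.one_ne_top)
      simpa using h2
  rw [lintegral_one, hν_inf] at hlim
  have h0 : P {ω | jumpMeasure (N ω) Set.univ = 0} ≤ 0 := by
    refine ge_of_tendsto' (x := Filter.atTop) ?_ hle
    simpa [Function.comp_def] using (continuous_expNeg.tendsto _).comp hlim
  rw [ae_iff]
  simpa using h0

end CRM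
end TiltedCRM

namespace TiltedCRM

variable {𝕏 : Type*} [MeasurableSpace 𝕏]

/-! ### The gamma density -/

/-- The library density also lives at `u = 0`; that point is null, so the open half-line suffices.
-/
theorem gammaMeasure_apply (a r : ℝ) {C : Set ℝ} (hC : MeasurableSet C) :
    gammaMeasure a r C = ∫⁻ u in Set.Ioi (0 : ℝ) ∩ C, ENNReal.ofReal
      (r ^ a / Real.Gamma a * u ^ (a - 1) * Real.exp (-(r * u))) := by
  rw [gammaMeasure, withDensity_apply _ hC, ← setLIntegral_indicator measurableSet_Ioi]
  refine lintegral_congr_ae ?_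
  have h0 : ∀ᵐ u ∂(volume.restrict C : Measure ℝ), u ≠ 0 :=
    ae_restrict_of_ae (Measure.ae_ne volume 0)
  filter_upwards [h0] with u hu
  rcases lt_or_gt_of_ne hu with h | h
  · rw [gammaPDF_of_neg h, Set.indicator_of_notMem (by simpa using h.le)]
  · rw [gammaPDF_of_nonneg h.le, Set.indicator_of_mem (by simpa using h)]

theorem measurable_gammaMeasure_apply (a : ℝ) {C : Set ℝ} (hC : MeasurableSet C) :
    Measurable fun r : ℝ => gammaMeasure a r C := by
  simp_rw [gammaMeasure_apply a _ hC]
  exact Measurable.lintegral_prod_right' (f := fun z : ℝ × ℝ => ENNReal.ofReal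
    (z.1 ^ a / Real.Gamma a * z.2 ^ (a - 1) * Real.exp (-(z.1 * z.2)))) (by fun_prop)

theorem measurable_polyExpTilt (γ q : ℝ) : Measurable (polyExpTilt γ q) := by
  unfold polyExpTilt
  fun_prop

theorem polyExpTilt_pos {γ q t : ℝ} (ht : 0 < t) : 0 < polyExpTilt γ q t :=
  mul_pos (Real.exp_pos _) (Real.rpow_pos_of_pos ht _)

/-- The powers of the total mass in the tilting factor, the normalization and the gamma density
cancel. -/
theorem tilt_mul_div_pow_mul_gamma {γ q : ℝ} (hγ : 0 ≤ γ) (hq : 0 ≤ q) {n : ℕ} (hn : 1 ≤ n)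
    {T : ℝ≥0∞} (hT0 : T ≠ 0) (hT : T ≠ ∞) (b : Fin n → ℝ≥0∞) {u : ℝ} (hu : 0 < u) :
    ENNReal.ofReal (polyExpTilt γ q T.toReal) * ((∏ i, b i / T) * ENNReal.ofReal
        (T.toReal ^ ((n : ℝ) + q) / Real.Gamma (n + q) * u ^ ((n : ℝ) + q - 1) *
          Real.exp (-(T.toReal * u)))) =
      (ENNReal.ofReal (Real.Gamma (n + q)))⁻¹ * (ENNReal.ofReal (u ^ ((n : ℝ) + q - 1)) *
        (expNeg (ENNReal.ofReal (γ + u) * T) * ∏ i, b i)) := by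
  have ht : 0 < T.toReal := ENNReal.toReal_pos hT0 hT
  have hTt : T = ENNReal.ofReal T.toReal := (ENNReal.ofReal_toReal hT).symm
  set t := T.toReal
  have hn' : (1 : ℝ) ≤ n := by exact_mod_cast hn
  have hG : 0 < Real.Gamma (n + q) := Real.Gamma_pos_of_pos (by linarith)
  have hprod : ∏ i, b i / T = (∏ i, b i) * ENNReal.ofReal ((t ^ n)⁻¹) := by
    simp_rw [div_eq_mul_inv]
    rw [Finset.prod_mul_distrib, Finset.prod_const, Finset.card_univ, Fintype.card_fin, hTt,
      ← ENNReal.ofReal_inv_of_pos ht, ← ENNReal.ofReal_pow (by positivity), inv_pow]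
  have hreal : polyExpTilt γ q t * ((t ^ n)⁻¹ * (t ^ ((n : ℝ) + q) / Real.Gamma (n + q) *
      u ^ ((n : ℝ) + q - 1) * Real.exp (-(t * u)))) =
        (Real.Gamma (n + q))⁻¹ * (u ^ ((n : ℝ) + q - 1) * Real.exp (-((γ + u) * t))) := by
    have h1 : t ^ (-q) * ((t ^ n)⁻¹ * t ^ ((n : ℝ) + q)) = 1 := by
      rw [Real.rpow_add ht, Real.rpow_natCast, ← mul_assoc (t ^ n)⁻¹,
        inv_mul_cancel₀ (by positivity), one_mul, ← Real.rpow_add ht, neg_add_cancel,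
        Real.rpow_zero]
    have h2 : Real.exp (-((γ + u) * t)) = Real.exp (-(γ * t)) * Real.exp (-(t * u)) := by
      rw [← Real.exp_add]
      congr 1
      ring
    rw [h2, polyExpTilt]
    linear_combination (Real.exp (-(γ * t)) * (Real.Gamma (n + q))⁻¹ * u ^ ((n : ℝ) + q - 1) *
      Real.exp (-(t * u))) * h1
  rw [hprod, hTt, ← ENNReal.ofReal_mul (by positivity), expNeg_ofReal (by positivity),
    ← ENNReal.ofReal_inv_of_pos hG]
  have hL := congrArg (fun r => (∏ i, b i) * ENNReal.ofReal r) hreal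
  rw [ENNReal.ofReal_mul (polyExpTilt_pos ht).le, ENNReal.ofReal_mul (by positivity),
    ENNReal.ofReal_mul (p := (Real.Gamma (n + q))⁻¹) (by positivity),
    ENNReal.ofReal_mul (p := u ^ ((n : ℝ) + q - 1)) (by positivity)] at hL
  convert! hL using 1 <;> ring

/-! ### The law of the sample and the auxiliary variable on rectangles -/

theorem measurable_uWeight {η : Measure 𝕏} [SFinite η] {ρ : Kernel 𝕏 ℝ} [IsSFiniteKernel ρ]
    (γ q : ℝ) (n : ℕ) {α : Type*} [MeasurableSpace α] {v : α → ℝ} {w : α → ℝ≥0∞}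
    (hv : Measurable v) (hw : Measurable w) :
    Measurable fun u => uWeight η ρ γ q n (v u) (w u) := by
  unfold uWeight
  have h : Measurable fun u => psi η ρ 0 (γ + v u) :=
    measurable_psi_zero.comp (hv.const_add γ)
  fun_prop

theorem lintegral_tiltedLaw_map (h : ℝ → ℝ) (hh : Measurable h) {Ω : Type*} [MeasurableSpace Ω]
    {P : Measure Ω} {μ : Ω → Measure 𝕏} (hμ : Measurable μ) {F : Measure 𝕏 → ℝ≥0∞}
    (hF : Measurable F) :
    ∫⁻ m, F m ∂(tiltedLaw h (P.map μ)) =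
      (∫⁻ ω, ENNReal.ofReal (h (μ ω Set.univ).toReal) ∂P)⁻¹ *
        ∫⁻ ω, ENNReal.ofReal (h (μ ω Set.univ).toReal) * F (μ ω) ∂P := by
  have hm : Measurable fun m : Measure 𝕏 => ENNReal.ofReal (h (m Set.univ).toReal) :=
    (hh.comp (Measure.measurable_coe MeasurableSet.univ).ennreal_toReal).ennreal_ofReal
  rw [tiltedLaw, lintegral_smul_measure, lintegral_withDensity_eq_lintegral_mul _ hm hF,
    lintegral_map hm hμ, lintegral_map (hm.mul hF) hμ]
  rfl

/-- Undo the tilt, cancel the powers of the total mass for almost every `ω`, exchange the integrals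
by Tonelli, and insert the Poisson moment formula at `a = γ + u > 0`. -/
theorem IsAugmentedSample.measure_rectangle
    {η : Measure 𝕏} [SFinite η] {ρ : Kernel 𝕏 ℝ} [IsSFiniteKernel ρ]
    (hρ : ∀ x, ρ x (Set.Iic 0) = 0)
    (hν_fin : ∀ s : ℝ, 0 < s → ∫⁻ z, ENNReal.ofReal (min z.2 s) ∂(intensity η ρ) < ∞)
    (hν_inf : intensity η ρ Set.univ = ∞)
    {Ω : Type*} [MeasurableSpace Ω] {P : Measure Ω} [IsProbabilityMeasure P]
    {N : Ω → Measure (𝕏 × ℝ)} (hN : IsPoissonProcess P N (intensity η ρ))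
    {γ q : ℝ} (hγ : 0 ≤ γ) (hq : 0 ≤ q) {n : ℕ} (hn : 1 ≤ n)
    {Ω' : Type*} [MeasurableSpace Ω'] {P' : Measure Ω'}
    {μt : Ω' → Measure 𝕏} {X : Ω' → Fin n → 𝕏} {U : Ω' → ℝ}
    (hμt : P'.map μt = tiltedLaw (polyExpTilt γ q) (P.map (fun ω => jumpMeasure (N ω))))
    (hXU : IsAugmentedSample P' q μt X U) {B : Fin n → Set 𝕏} (hB : ∀ i, MeasurableSet (B i))
    {C : Set ℝ} (hC : MeasurableSet C) :
    P' {ω | (∀ i, X ω i ∈ B i) ∧ U ω ∈ C} =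
      (∫⁻ ω, ENNReal.ofReal (polyExpTilt γ q (jumpMeasure (N ω) Set.univ).toReal) ∂P)⁻¹ *
        ((ENNReal.ofReal (Real.Gamma (n + q)))⁻¹ * ∫⁻ u in Set.Ioi (0 : ℝ) ∩ C,
          uWeight η ρ γ q n u (∑ p : IndexPartition n, ∏ c ∈ p.parts,
            ∫⁻ x, (∏ i ∈ c, (B i).indicator 1 x) * tau ρ c.card x (γ + u) ∂η)) := by
  have hμ : Measurable fun ω => jumpMeasure (N ω) := measurable_jumpMeasure.comp hN.measurable
  have hT := measurable_jumpMeasure_univ hN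
  have hμB : ∀ i, Measurable fun ω => jumpMeasure (N ω) (B i) :=
    fun i => (Measure.measurable_coe (hB i)).comp hμ
  have hS : MeasurableSet (Set.Ioi (0 : ℝ) ∩ C) := measurableSet_Ioi.inter hC
  let F : Measure 𝕏 → ℝ≥0∞ := fun m =>
    (∏ i, m (B i) / m Set.univ) * gammaMeasure (n + q) (m Set.univ).toReal C
  have hF : Measurable F := by
    refine (Finset.measurable_fun_prod _ fun i _ => (Measure.measurable_coe (hB i)).div
      (Measure.measurable_coe MeasurableSet.univ)).mul ?_
    exact (measurable_gammaMeasure_apply _ hC).comp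
      (Measure.measurable_coe MeasurableSet.univ).ennreal_toReal
  have h1 : P' {ω | (∀ i, X ω i ∈ B i) ∧ U ω ∈ C} = ∫⁻ m, F m ∂(P'.map μt) := by
    have := hXU.joint_law Set.univ B C MeasurableSet.univ hB hC
    simp only [Set.mem_univ, true_and, Set.preimage_univ, Measure.restrict_univ] at this
    rw [this, lintegral_map hF hXU.measurable_measure]
  rw [h1, hμt, lintegral_tiltedLaw_map _ (measurable_polyExpTilt γ q) hμ hF]
  congr 1
  have h2 : ∀ᵐ ω ∂P, ENNReal.ofReal (polyExpTilt γ q (jumpMeasure (N ω) Set.univ).toReal) *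
      F (jumpMeasure (N ω)) = ∫⁻ u in Set.Ioi (0 : ℝ) ∩ C,
        (ENNReal.ofReal (Real.Gamma (n + q)))⁻¹ * (ENNReal.ofReal (u ^ ((n : ℝ) + q - 1)) *
          (expNeg (ENNReal.ofReal (γ + u) * jumpMeasure (N ω) Set.univ) *
            ∏ i, jumpMeasure (N ω) (B i))) := by
    filter_upwards [ae_jumpMeasure_univ_ne_top hρ hν_fin hN,
      ae_jumpMeasure_univ_ne_zero hρ hν_fin hν_inf hN] with ω hω hω0
    simp only [F]
    rw [gammaMeasure_apply _ _ hC, ← lintegral_const_mul _ (by fun_prop),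
      ← lintegral_const_mul _ (by fun_prop)]
    exact setLIntegral_congr_fun hS fun u hu =>
      tilt_mul_div_pow_mul_gamma hγ hq hn hω0 hω _ hu.1
  rw [lintegral_congr_ae h2, lintegral_lintegral_swap]
  · have hG : (ENNReal.ofReal (Real.Gamma (n + q)))⁻¹ ≠ ∞ := by
      have hn' : (1 : ℝ) ≤ n := by exact_mod_cast hn
      exact ENNReal.inv_ne_top.2
        (ENNReal.ofReal_pos.2 (Real.Gamma_pos_of_pos (by linarith))).ne'
    rw [← lintegral_const_mul' _ _ hG]
    refine setLIntegral_congr_fun hS fun u hu => ?_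
    have ha : 0 < γ + u := add_pos_of_nonneg_of_pos hγ hu.1
    rw [lintegral_const_mul' _ _ hG, lintegral_const_mul' _ _ ENNReal.ofReal_ne_top,
      lintegral_expNeg_mul_prod_jumpMeasure hρ hν_fin hN ha hB, uWeight,
      ← expNeg_of_ne_top (psi_zero_lt_top hρ hν_fin ha).ne]
    ring
  · have hT' : Measurable fun z : Ω × ℝ => jumpMeasure (N z.1) Set.univ :=
      hT.comp measurable_fst
    have hB' : Measurable fun z : Ω × ℝ => ∏ i, jumpMeasure (N z.1) (B i) :=
      Finset.measurable_fun_prod _ fun i _ => (hμB i).comp measurable_fst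
    refine Measurable.aemeasurable ?_
    change Measurable fun z : Ω × ℝ =>
      (ENNReal.ofReal (Real.Gamma (n + q)))⁻¹ * (ENNReal.ofReal (z.2 ^ ((n : ℝ) + q - 1)) *
          (expNeg (ENNReal.ofReal (γ + z.2) * jumpMeasure (N z.1) Set.univ) *
            ∏ i, jumpMeasure (N z.1) (B i)))
    fun_prop

end TiltedCRM

namespace TiltedCRM

/-! ### Vectors with prescribed ties -/

section Ties

variable {𝕏 : Type*} {n : ℕ}

/-- The vector that is constant on the cells of `p`, with the values `y`. -/
def spread (p : IndexPartition n) (y : {c // c ∈ p.parts} → 𝕏) : Fin n → 𝕏 :=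
  fun i => y ⟨p.part i, p.part_mem.2 (Finset.mem_univ i)⟩

theorem spread_of_mem (p : IndexPartition n) (y : {c // c ∈ p.parts} → 𝕏)
    (c : {c // c ∈ p.parts}) {i : Fin n} (hi : i ∈ c.1) : spread p y i = y c := by
  unfold spread
  congr 1
  exact Subtype.ext (p.part_eq_of_mem c.2 hi)

theorem cellValues_spread (p : IndexPartition n) (y : {c // c ∈ p.parts} → 𝕏) :
    cellValues p (spread p y) = y :=
  funext fun c => spread_of_mem p y c (Finset.min'_mem _ _)

theorem finpartition_ext_part {α : Type*} [DecidableEq α] {s : Finset α} {p p' : Finpartition s}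
    (h : ∀ i ∈ s, p.part i = p'.part i) : p = p' := by
  have key : ∀ p : Finpartition s, p.parts = s.image p.part := by
    intro p
    ext c
    rw [Finset.mem_image]
    constructor
    · intro hc
      obtain ⟨i, hi⟩ := p.nonempty_of_mem_parts hc
      exact ⟨i, p.le hc hi, p.part_eq_of_mem hc hi⟩
    · rintro ⟨i, hi, rfl⟩
      exact p.part_mem.2 hi
  exact Finpartition.ext ((key p).trans ((Finset.image_congr h).trans (key p').symm))

theorem tiePartition_eq_iff (p : IndexPartition n) (x : Fin n → 𝕏) :
    tiePartition x = p ↔ ∀ i j, x i = x j ↔ j ∈ p.part i := by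
  constructor
  · rintro rfl i j
    exact (mem_part_tiePartition x i j).symm
  · intro h
    refine finpartition_ext_part fun i _ => ?_
    ext j
    rw [mem_part_tiePartition, h]

/-- Without injectivity, equal values would merge cells and the ties would be coarser than `p`. -/
theorem tiePartition_spread (p : IndexPartition n) {y : {c // c ∈ p.parts} → 𝕏}
    (hy : Function.Injective y) : tiePartition (spread p y) = p := by
  rw [tiePartition_eq_iff]
  intro i j
  unfold spread
  rw [hy.eq_iff, Subtype.mk.injEq, p.mem_part_iff_part_eq_part (Finset.mem_univ j)
    (Finset.mem_univ i), eq_comm]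

theorem prod_spread {R : Type*} [CommMonoid R] (p : IndexPartition n)
    (y : {c // c ∈ p.parts} → 𝕏) (f : Fin n → 𝕏 → R) :
    ∏ i, f i (spread p y i) = ∏ c : {c // c ∈ p.parts}, ∏ i ∈ c.1, f i (y c) := by
  have h1 : ∏ i, f i (spread p y i) = ∏ c ∈ p.parts, ∏ i ∈ c, f i (spread p y i) := by
    conv_lhs => rw [← p.biUnion_parts]
    exact Finset.prod_biUnion p.disjoint
  rw [h1, ← Finset.prod_coe_sort]
  exact Finset.prod_congr rfl fun c _ => Finset.prod_congr rfl fun i hi => by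
    rw [spread_of_mem p y c hi]

variable [MeasurableSpace 𝕏]

theorem measurable_spread (p : IndexPartition n) :
    Measurable (spread p : ({c // c ∈ p.parts} → 𝕏) → Fin n → 𝕏) :=
  measurable_pi_lambda _ fun _ => measurable_pi_apply _

theorem measurable_cellValues (p : IndexPartition n) :
    Measurable (cellValues p : (Fin n → 𝕏) → {c // c ∈ p.parts} → 𝕏) :=
  measurable_pi_lambda _ fun _ => measurable_pi_apply _

theorem measurableSet_tiePartition_eq [MeasurableEq 𝕏] (p : IndexPartition n) :
    MeasurableSet {x : Fin n → 𝕏 | tiePartition x = p} := by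
  simp_rw [tiePartition_eq_iff]
  simp only [Set.ofPred_forall]
  refine MeasurableSet.iInter fun i => MeasurableSet.iInter fun j => ?_
  have h : MeasurableSet {x : Fin n → 𝕏 | x i = x j} :=
    measurableSet_eq_fun (measurable_pi_apply i) (measurable_pi_apply j)
  by_cases hj : j ∈ p.part i
  · simpa only [hj, iff_true] using h
  · simp only [hj, iff_false]
    exact h.compl

theorem measurableSet_tiePartition_cellValues [MeasurableEq 𝕏] (p : IndexPartition n)
    {D : Set ({c // c ∈ p.parts} → 𝕏)} (hD : MeasurableSet D) :
    MeasurableSet {x : Fin n → 𝕏 | tiePartition x = p ∧ cellValues p x ∈ D} :=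
  (measurableSet_tiePartition_eq p).inter (measurable_cellValues p hD)

end Ties

/-! ### Products of a non-atomic probability measure -/

section Product

variable {𝕏 : Type*} [MeasurableSpace 𝕏] {η : Measure 𝕏} [IsProbabilityMeasure η]
  {ι : Type*} [Fintype ι]

theorem lintegral_pi_prod {f : ι → 𝕏 → ℝ≥0∞} (hf : ∀ i, Measurable (f i)) :
    ∫⁻ y, ∏ i, f i (y i) ∂(Measure.pi fun _ : ι => η) = ∏ i, ∫⁻ x, f i x ∂η := by
  have hind : iIndepFun (fun i (y : ι → 𝕏) => f i (y i)) (Measure.pi fun _ : ι => η) :=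
    iIndepFun_pi fun i => (hf i).aemeasurable
  rw [lintegral_prod_eq_prod_lintegral_of_indepFun Finset.univ _ hind
    fun i => (hf i).comp (measurable_pi_apply i)]
  exact Finset.prod_congr rfl fun i _ =>
    (measurePreserving_eval (fun _ : ι => η) i).lintegral_comp (hf i)

/-- Two distinct coordinates have law `η × η`, for which the diagonal is null because every section
is a point. There are finitely many pairs. -/
theorem ae_pi_injective [MeasurableEq 𝕏] [NullSingletonClass η] :
    ∀ᵐ y ∂(Measure.pi fun _ : ι => η), Function.Injective y := by
  have h : ∀ i j : ι, i ≠ j → ∀ᵐ y ∂(Measure.pi fun _ : ι => η), y i ≠ y j := by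
    intro i j hij
    have hind : iIndepFun (fun i (y : ι → 𝕏) => y i) (Measure.pi fun _ : ι => η) :=
      iIndepFun_pi (X := fun _ => id) fun _ => aemeasurable_id
    have hmap := (indepFun_iff_map_prod_eq_prod_map_map (measurable_pi_apply i).aemeasurable
      (measurable_pi_apply j).aemeasurable).1 (hind.indepFun hij)
    rw [(measurePreserving_eval (fun _ : ι => η) i).map_eq,
      (measurePreserving_eval (fun _ : ι => η) j).map_eq] at hmap
    have hd : MeasurableSet {z : 𝕏 × 𝕏 | z.1 ≠ z.2} :=
      (measurableSet_eq_fun measurable_fst measurable_snd).compl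
    have hprod : ∀ᵐ z ∂(η.prod η), z.1 ≠ z.2 := by
      rw [Measure.ae_prod_iff_ae_ae hd]
      exact Filter.Eventually.of_forall fun x => (Measure.ae_ne η x).mono fun _ h => h.symm
    rw [← hmap] at hprod
    exact ae_of_ae_map ((measurable_pi_apply i).prodMk (measurable_pi_apply j)).aemeasurable hprod
  have h2 : ∀ᵐ y ∂(Measure.pi fun _ : ι => η), ∀ i j, i ≠ j → y i ≠ y j := by
    simp only [ae_all_iff]
    exact h
  exact h2.mono fun y hy i j hij => by_contra fun hne => hy i j hne hij

end Product

/-! ### The law of the sample and the auxiliary variable -/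

section Law

variable {𝕏 : Type*} [MeasurableSpace 𝕏]

theorem lintegral_uWeight (η : Measure 𝕏) (ρ : Kernel 𝕏 ℝ) (n : ℕ) (γ q u : ℝ) {α : Type*} [MeasurableSpace α] (μ : Measure α)
    {w : α → ℝ≥0∞} (hw : Measurable w) :
    ∫⁻ y, uWeight η ρ γ q n u (w y) ∂μ = uWeight η ρ γ q n u (∫⁻ y, w y ∂μ) := by
  unfold uWeight
  rw [lintegral_mul_const _ (by fun_prop), lintegral_const_mul _ hw]

theorem uWeight_sum (η : Measure 𝕏) (ρ : Kernel 𝕏 ℝ) (n : ℕ) (γ q u : ℝ) {ι : Type*} (s : Finset ι) (w : ι → ℝ≥0∞) :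
    uWeight η ρ γ q n u (∑ i ∈ s, w i) = ∑ i ∈ s, uWeight η ρ γ q n u (w i) := by
  unfold uWeight
  rw [Finset.mul_sum, Finset.sum_mul]

variable {η : Measure 𝕏} [IsProbabilityMeasure η]
  {ρ : Kernel 𝕏 ℝ} [IsSFiniteKernel ρ] {n : ℕ}

theorem measurable_tauProd (p : IndexPartition n) :
    Measurable fun z : ({c // c ∈ p.parts} → 𝕏) × ℝ => tauProd ρ p z.1 z.2 :=
  Finset.measurable_fun_prod _ fun c _ => (measurable_tau c.1.card).comp
    (((measurable_pi_apply c).comp measurable_fst).prodMk measurable_snd)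

theorem measurable_kappaProd (p : IndexPartition n) :
    Measurable fun a : ℝ => kappaProd η ρ p a :=
  Finset.measurable_fun_prod _ fun c _ => measurable_kappa c.card

theorem lintegral_tauProd (p : IndexPartition n) (a : ℝ) :
    ∫⁻ y, tauProd ρ p y a ∂(Measure.pi fun _ => η) = kappaProd η ρ p a := by
  unfold tauProd kappaProd
  rw [lintegral_pi_prod (f := fun c : {c // c ∈ p.parts} => fun x => tau ρ c.1.card x a)
    fun c => measurable_tau_left _ _]
  exact Finset.prod_coe_sort p.parts fun c => kappa η ρ c.card a

theorem lintegral_lintegral_uWeight_swap (γ q : ℝ) (p : IndexPartition n)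
    (μ : Measure ({c // c ∈ p.parts} → 𝕏)) [SFinite μ] (f : ({c // c ∈ p.parts} → 𝕏) → ℝ≥0∞)
    (hf : Measurable f) (C : Set ℝ) :
    ∫⁻ y, f y * (∫⁻ u in C, uWeight η ρ γ q n u (tauProd ρ p y (γ + u))) ∂μ =
      ∫⁻ u in C, uWeight η ρ γ q n u (∫⁻ y, f y * tauProd ρ p y (γ + u) ∂μ) := by
  have hm : Measurable fun z : ({c // c ∈ p.parts} → 𝕏) × ℝ => tauProd ρ p z.1 (γ + z.2) :=
    (measurable_tauProd p).comp (measurable_fst.prodMk (measurable_snd.const_add γ))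
  have hm' := measurable_uWeight (η := η) (ρ := ρ) γ q n measurable_snd
    ((hf.comp measurable_fst).mul hm)
  have h : ∀ y, f y * ∫⁻ u in C, uWeight η ρ γ q n u (tauProd ρ p y (γ + u)) =
      ∫⁻ u in C, uWeight η ρ γ q n u (f y * tauProd ρ p y (γ + u)) := fun y => by
    have hmy : Measurable fun u : ℝ => uWeight η ρ γ q n u (tauProd ρ p y (γ + u)) :=
      measurable_uWeight γ q n measurable_id (hm.comp measurable_prodMk_left)
    rw [← lintegral_const_mul _ hmy]
    refine lintegral_congr fun u => ?_
    unfold uWeight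
    ring
  simp_rw [h]
  rw [lintegral_lintegral_swap (by exact hm'.aemeasurable)]
  exact lintegral_congr fun u => lintegral_uWeight η ρ n γ q u μ
    (hf.mul (hm.comp measurable_prodMk_right))

theorem setLIntegral_lintegral_uWeight_swap (γ q : ℝ) (p : IndexPartition n)
    (D : Set ({c // c ∈ p.parts} → 𝕏)) (C : Set ℝ) :
    ∫⁻ y in D, (∫⁻ u in C, uWeight η ρ γ q n u (tauProd ρ p y (γ + u)))
        ∂(Measure.pi fun _ => η) =
      ∫⁻ u in C, uWeight η ρ γ q n u
        (∫⁻ y in D, tauProd ρ p y (γ + u) ∂(Measure.pi fun _ => η)) := by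
  simpa using lintegral_lintegral_uWeight_swap (η := η) (ρ := ρ) γ q p
    ((Measure.pi fun _ => η).restrict D) (fun _ => 1) measurable_const C

/-- On the vectors with ties given by `p`, the law of the sample restricted to an event of the
auxiliary variable has this form, up to a constant factor. -/
noncomputable def cellMeasure (η : Measure 𝕏) (ρ : Kernel 𝕏 ℝ) (γ q : ℝ)
    (C : Set ℝ) (p : IndexPartition n) : Measure ({c // c ∈ p.parts} → 𝕏) :=
  (Measure.pi fun _ => η).withDensity fun y =>
    ∫⁻ u in Set.Ioi (0 : ℝ) ∩ C, uWeight η ρ γ q n u (tauProd ρ p y (γ + u))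

/-- The preimage of a rectangle under `spread p` constrains each cell value separately, so the
product measure factors over the cells. -/
theorem cellMeasure_spread_rectangle (γ q : ℝ) (C : Set ℝ) (p : IndexPartition n)
    {B : Fin n → Set 𝕏} (hB : ∀ i, MeasurableSet (B i)) :
    (cellMeasure η ρ γ q C p).map (spread p) (Set.univ.pi B) =
      ∫⁻ u in Set.Ioi (0 : ℝ) ∩ C, uWeight η ρ γ q n u (∏ c ∈ p.parts,
        ∫⁻ x, (∏ i ∈ c, (B i).indicator 1 x) * tau ρ c.card x (γ + u) ∂η) := by
  have hR : MeasurableSet (Set.univ.pi B) := MeasurableSet.univ_pi hB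
  have hind : ∀ y : {c // c ∈ p.parts} → 𝕏,
      (spread p ⁻¹' Set.univ.pi B).indicator (1 : ({c // c ∈ p.parts} → 𝕏) → ℝ≥0∞) y =
        ∏ c : {c // c ∈ p.parts}, ∏ i ∈ c.1, (B i).indicator 1 (y c) := by
    intro y
    rw [← prod_spread p y fun i => (B i).indicator (1 : 𝕏 → ℝ≥0∞)]
    by_cases hy : spread p y ∈ Set.univ.pi B
    · rw [Set.indicator_of_mem (by exact hy), Finset.prod_eq_one fun i _ => ?_]
      · rfl
      · exact Set.indicator_of_mem (hy i trivial) _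
    · rw [Set.indicator_of_notMem (by exact hy)]
      simp only [Set.mem_pi, Set.mem_univ, true_implies, not_forall] at hy
      obtain ⟨i, hi⟩ := hy
      exact (Finset.prod_eq_zero (Finset.mem_univ i) (Set.indicator_of_notMem hi _)).symm
  rw [Measure.map_apply (measurable_spread p) hR, cellMeasure,
    withDensity_apply _ (measurable_spread p hR), ← lintegral_indicator (measurable_spread p hR)]
  have h1 : ∀ y, (spread p ⁻¹' Set.univ.pi B).indicator (fun y =>
      ∫⁻ u in Set.Ioi (0 : ℝ) ∩ C, uWeight η ρ γ q n u (tauProd ρ p y (γ + u))) y =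
        (∏ c : {c // c ∈ p.parts}, ∏ i ∈ c.1, (B i).indicator 1 (y c)) *
          ∫⁻ u in Set.Ioi (0 : ℝ) ∩ C, uWeight η ρ γ q n u (tauProd ρ p y (γ + u)) := by
    intro y
    rw [← hind]
    by_cases hy : y ∈ spread p ⁻¹' Set.univ.pi B <;> simp [hy]
  have hBm : ∀ i, Measurable ((B i).indicator (1 : 𝕏 → ℝ≥0∞)) :=
    fun i => measurable_one.indicator (hB i)
  have hf : Measurable fun y : {c // c ∈ p.parts} → 𝕏 =>
      ∏ c : {c // c ∈ p.parts}, ∏ i ∈ c.1, (B i).indicator (1 : 𝕏 → ℝ≥0∞) (y c) :=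
    Finset.measurable_fun_prod _ fun c _ => Finset.measurable_fun_prod _ fun i _ =>
      (hBm i).comp (measurable_pi_apply c)
  simp_rw [h1]
  rw [lintegral_lintegral_uWeight_swap γ q p _ _ hf]
  refine lintegral_congr fun u => ?_
  congr 1
  unfold tauProd
  simp_rw [← Finset.prod_mul_distrib]
  rw [lintegral_pi_prod (f := fun c : {c // c ∈ p.parts} => fun x =>
    (∏ i ∈ c.1, (B i).indicator 1 x) * tau ρ c.1.card x (γ + u))
    (fun c => (Finset.measurable_fun_prod _ fun i _ => hBm i).mul (measurable_tau_left _ _))]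
  exact Finset.prod_coe_sort p.parts fun c =>
    ∫⁻ x, (∏ i ∈ c, (B i).indicator 1 x) * tau ρ c.card x (γ + u) ∂η

/-- A measure on the samples that agrees on rectangles with the mixture over the partitions is that
mixture, and gives the joint law of the ties and the distinct values. -/
theorem measure_tiePartition_cellValues_of_rectangle [MeasurableEq 𝕏] [NullSingletonClass η]
    {Q : Measure (Fin n → 𝕏)} [IsFiniteMeasure Q] (γ q : ℝ) (C : Set ℝ) (K : ℝ≥0∞)
    (hQ : ∀ B : Fin n → Set 𝕏, (∀ i, MeasurableSet (B i)) → Q (Set.univ.pi B) =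
      K * ∫⁻ u in Set.Ioi (0 : ℝ) ∩ C, uWeight η ρ γ q n u (∑ p : IndexPartition n,
        ∏ c ∈ p.parts, ∫⁻ x, (∏ i ∈ c, (B i).indicator 1 x) * tau ρ c.card x (γ + u) ∂η))
    (p : IndexPartition n) {D : Set ({c // c ∈ p.parts} → 𝕏)} (hD : MeasurableSet D) :
    Q {x | tiePartition x = p ∧ cellValues p x ∈ D} =
      K * ∫⁻ y in D, (∫⁻ u in Set.Ioi (0 : ℝ) ∩ C,
        uWeight η ρ γ q n u (tauProd ρ p y (γ + u))) ∂(Measure.pi fun _ => η) := by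
  have hrect : ∀ B : Fin n → Set 𝕏, (∀ i, MeasurableSet (B i)) → Q (Set.univ.pi B) =
      (K • ∑ p : IndexPartition n, (cellMeasure η ρ γ q C p).map (spread p)) (Set.univ.pi B) := by
    intro B hB
    have hm : ∀ c : Finset (Fin n), Measurable fun u : ℝ =>
        ∫⁻ x, (∏ i ∈ c, (B i).indicator 1 x) * tau ρ c.card x (γ + u) ∂η := fun c =>
      Measurable.lintegral_prod_left' (f := fun z : 𝕏 × ℝ =>
        (∏ i ∈ c, (B i).indicator 1 z.1) * tau ρ c.card z.1 (γ + z.2))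
        ((Finset.measurable_fun_prod _ fun i _ =>
          (measurable_one.indicator (hB i)).comp measurable_fst).mul
          ((measurable_tau c.card).comp (measurable_fst.prodMk (measurable_snd.const_add γ))))
    rw [hQ B hB, Measure.smul_apply, Measure.finsetSum_apply, smul_eq_mul]
    congr 1
    simp_rw [uWeight_sum]
    have hm' : ∀ p : IndexPartition n, Measurable fun u : ℝ => uWeight η ρ γ q n u
        (∏ c ∈ p.parts, ∫⁻ x, (∏ i ∈ c, (B i).indicator 1 x) * tau ρ c.card x (γ + u) ∂η) :=
      fun p => measurable_uWeight γ q n measurable_id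
        (Finset.measurable_fun_prod _ fun c _ => hm c)
    rw [lintegral_finsetSum _ fun p _ => hm' p]
    exact Finset.sum_congr rfl fun p _ => (cellMeasure_spread_rectangle γ q C p hB).symm
  -- Rectangles form a generating π-system, and `Q` is finite.
  have hQeq : Q = K • ∑ p : IndexPartition n, (cellMeasure η ρ γ q C p).map (spread p) := by
    refine ext_of_generate_finite _ generateFrom_pi.symm isPiSystem_pi ?_ ?_
    · rintro s ⟨B, hB, rfl⟩
      exact hrect B fun i => hB i trivial
    · simpa using hrect (fun _ => Set.univ) fun _ => MeasurableSet.univ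
  have hE := measurableSet_tiePartition_cellValues p hD
  rw [hQeq, Measure.smul_apply, Measure.finsetSum_apply, smul_eq_mul]
  congr 1
  have hinj : ∀ p' : IndexPartition n, ∀ᵐ y ∂(cellMeasure η ρ γ q C p'), Function.Injective y :=
    fun p' => (withDensity_absolutelyContinuous _ _).ae_le ae_pi_injective
  -- Almost surely a vector from the component `p'` has ties exactly `p'`, so only `p' = p` charges
  -- the event.
  rw [Finset.sum_eq_single p]
  · rw [Measure.map_apply (measurable_spread p) hE, ← withDensity_apply _ hD]
    refine measure_congr ?_
    filter_upwards [hinj p] with y hy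
    refine propext ?_
    change (tiePartition (spread p y) = p ∧ cellValues p (spread p y) ∈ D) ↔ y ∈ D
    rw [tiePartition_spread p hy, cellValues_spread]
    simp
  · intro p' _ hp'
    rw [Measure.map_apply (measurable_spread p') hE, measure_eq_zero_iff_ae_notMem]
    filter_upwards [hinj p'] with y hy h
    exact hp' ((tiePartition_spread p' hy).symm.trans h.1)
  · exact fun h => absurd (Finset.mem_univ p) h

end Law
end TiltedCRM

namespace TiltedCRM

/-! ### Positivity and finiteness of the cumulants -/

section Positivity

theorem uWeight_ne_zero {𝕏 : Type*} [MeasurableSpace 𝕏] {η : Measure 𝕏} {ρ : Kernel 𝕏 ℝ}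
    {n : ℕ} {γ q u : ℝ} (hu : 0 < u) {w : ℝ≥0∞} (hw : w ≠ 0) :
    uWeight η ρ γ q n u w ≠ 0 :=
  mul_ne_zero (mul_ne_zero (ENNReal.ofReal_pos.2 (Real.exp_pos _)).ne' hw)
    (ENNReal.ofReal_pos.2 (Real.rpow_pos_of_pos hu _)).ne'

variable {𝕏 : Type*} [MeasurableSpace 𝕏] {η : Measure 𝕏} [SFinite η]
  {ρ : Kernel 𝕏 ℝ} [IsSFiniteKernel ρ] {n : ℕ}

theorem kappaProd_pos (hρ : ∀ x, ρ x (Set.Iic 0) = 0) (hν : intensity η ρ ≠ 0)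
    (p : IndexPartition n) {a : ℝ} (ha : 0 ≤ a) : 0 < kappaProd η ρ p a := by
  rw [pos_iff_ne_zero, kappaProd, Finset.prod_ne_zero_iff]
  exact fun c _ => (kappa_pos hρ hν c.card ha).ne'

theorem kappaProd_lt_top (hρ : ∀ x, ρ x (Set.Iic 0) = 0)
    (hν_fin : ∀ s : ℝ, 0 < s → ∫⁻ z, ENNReal.ofReal (min z.2 s) ∂(intensity η ρ) < ∞)
    (p : IndexPartition n) {a : ℝ} (ha : 0 < a) : kappaProd η ρ p a < ∞ :=
  ENNReal.prod_lt_top fun _ hc =>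
    kappa_lt_top hν_fin hρ (Finset.card_pos.2 (p.nonempty_of_mem_parts hc)) ha

theorem measurable_uWeight_kappaProd (γ q : ℝ) (p : IndexPartition n) :
    Measurable fun u : ℝ => uWeight η ρ γ q n u (kappaProd η ρ p (γ + u)) :=
  measurable_uWeight γ q n measurable_id
    (Finset.measurable_fun_prod _ fun c _ => (measurable_kappa c.card).comp
      (measurable_id.const_add γ))

theorem kappaIntegral_pos (hρ : ∀ x, ρ x (Set.Iic 0) = 0) (hν : intensity η ρ ≠ 0)
    {γ : ℝ} (hγ : 0 ≤ γ) (q : ℝ) (p : IndexPartition n) : 0 < kappaIntegral η ρ γ q p := by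
  rw [pos_iff_ne_zero, kappaIntegral, Ne, lintegral_eq_zero_iff (measurable_uWeight_kappaProd γ q p),
    Filter.EventuallyEq, ae_restrict_iff' measurableSet_Ioi]
  intro h
  have h0 : volume (Set.Ioi (0 : ℝ)) = 0 := by
    rw [measure_eq_zero_iff_ae_notMem]
    exact h.mono fun u hu hu0 => uWeight_ne_zero hu0
      (kappaProd_pos hρ hν p (add_nonneg hγ (le_of_lt hu0))).ne' (hu hu0)
  simp at h0

end Positivity

/-! ### Conditional probabilities given a real random variable -/

/-- The defining property of conditional expectation, tested on the events `U ∈ C`. Integrability of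
`G(U)` comes from the case where `C` is the whole line. -/
theorem condExp_indicator_comap_ae_eq {Ω : Type*} [MeasurableSpace Ω] {P : Measure Ω}
    [IsProbabilityMeasure P] {U : Ω → ℝ} (hU : Measurable U) {E : Set Ω} (hE : MeasurableSet E)
    {G : ℝ → ℝ≥0∞} (hG : Measurable G)
    (h : ∀ C, MeasurableSet C → ∫⁻ ω in U ⁻¹' C, G (U ω) ∂P = P (E ∩ U ⁻¹' C)) :
    P⟦E | MeasurableSpace.comap U inferInstance⟧ =ᵐ[P] fun ω => (G (U ω)).toReal := by
  have hGU : Measurable fun ω => G (U ω) := hG.comp hU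
  have hfin : ∫⁻ ω, G (U ω) ∂P ≠ ∞ := by
    have := h Set.univ MeasurableSet.univ
    rw [Set.preimage_univ, Measure.restrict_univ] at this
    rw [this]
    exact measure_ne_top _ _
  have hint : Integrable (fun ω => (G (U ω)).toReal) P :=
    integrable_toReal_of_lintegral_ne_top hGU.aemeasurable hfin
  symm
  refine ae_eq_condExp_of_forall_setIntegral_eq hU.comap_le
    ((integrable_const (1 : ℝ)).indicator hE) (fun s _ _ => hint.integrableOn) ?_ ?_
  · rintro s ⟨C, hC, rfl⟩ _
    rw [integral_toReal hGU.aemeasurable (ae_restrict_of_ae (ae_lt_top hGU hfin)), h C hC,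
      setIntegral_indicator hE, setIntegral_const, smul_eq_mul, mul_one, measureReal_def,
      Set.inter_comm]
  · exact (hG.ennreal_toReal.comp (comap_measurable U)).aestronglyMeasurable

theorem sum_measure_tiePartition {𝕏 : Type*} [MeasurableSpace 𝕏] [MeasurableEq 𝕏] {n : ℕ}
    {Ω' : Type*} [MeasurableSpace Ω'] {P' : Measure Ω'} {X : Ω' → Fin n → 𝕏} (hX : Measurable X)
    {S : Set Ω'} (hS : MeasurableSet S) :
    ∑ p : IndexPartition n, P' ({ω | tiePartition (X ω) = p} ∩ S) = P' S := by
  have hm : ∀ p : IndexPartition n, MeasurableSet ({ω | tiePartition (X ω) = p} ∩ S) :=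
    fun p => (hX (measurableSet_tiePartition_eq p)).inter hS
  rw [← measure_biUnion_finset (fun p _ p' _ hpp' => ?_) fun p _ => hm p]
  · congr 1
    ext ω
    simp
  · exact Set.disjoint_left.2 fun ω h h' => hpp' (h.1.symm.trans h'.1)

/-! ### Normalization of the joint law -/

section Main

variable {𝕏 : Type*} [MeasurableSpace 𝕏] {η : Measure 𝕏} [IsProbabilityMeasure η]
  {ρ : Kernel 𝕏 ℝ} [IsSFiniteKernel ρ] {n : ℕ}

theorem setLIntegral_tauProd_univ (γ q : ℝ) (p : IndexPartition n) :
    ∫⁻ u in Set.Ioi (0 : ℝ) ∩ Set.univ, uWeight η ρ γ q n u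
      (∫⁻ y in Set.univ, tauProd ρ p y (γ + u) ∂(Measure.pi fun _ => η)) =
        kappaIntegral η ρ γ q p := by
  simp_rw [Measure.restrict_univ, lintegral_tauProd, Set.inter_univ]
  rfl

variable {Ω' : Type*} [MeasurableSpace Ω'] {P' : Measure Ω'} [IsProbabilityMeasure P']

/-- The joint law of the ties, the distinct values and the auxiliary variable. -/
theorem IsAugmentedSample.measure_tiePartition_cellValues
    [MeasurableEq 𝕏] [NullSingletonClass η]
    (hρ : ∀ x, ρ x (Set.Iic 0) = 0)
    (hν_fin : ∀ s : ℝ, 0 < s → ∫⁻ z, ENNReal.ofReal (min z.2 s) ∂(intensity η ρ) < ∞)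
    (hν_inf : intensity η ρ Set.univ = ∞)
    {Ω : Type*} [MeasurableSpace Ω] {P : Measure Ω} [IsProbabilityMeasure P]
    {N : Ω → Measure (𝕏 × ℝ)} (hN : IsPoissonProcess P N (intensity η ρ))
    {γ q : ℝ} (hγ : 0 ≤ γ) (hq : 0 ≤ q) (hn : 1 ≤ n)
    {μt : Ω' → Measure 𝕏} {X : Ω' → Fin n → 𝕏} {U : Ω' → ℝ}
    (hμt : P'.map μt = tiltedLaw (polyExpTilt γ q) (P.map (fun ω => jumpMeasure (N ω))))
    (hXU : IsAugmentedSample P' q μt X U) :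
    (∑ p' : IndexPartition n, kappaIntegral η ρ γ q p') ≠ ∞ ∧
    ∀ (p : IndexPartition n) (D : Set ({c // c ∈ p.parts} → 𝕏)), MeasurableSet D →
      ∀ C : Set ℝ, MeasurableSet C →
      P' ({ω | tiePartition (X ω) = p ∧ cellValues p (X ω) ∈ D} ∩ U ⁻¹' C) =
        (∑ p' : IndexPartition n, kappaIntegral η ρ γ q p')⁻¹ *
          ∫⁻ u in Set.Ioi (0 : ℝ) ∩ C, uWeight η ρ γ q n u
            (∫⁻ y in D, tauProd ρ p y (γ + u) ∂(Measure.pi fun _ => η)) := by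
  set K : ℝ≥0∞ :=
    (∫⁻ ω, ENNReal.ofReal (polyExpTilt γ q (jumpMeasure (N ω) Set.univ).toReal) ∂P)⁻¹ *
      (ENNReal.ofReal (Real.Gamma (n + q)))⁻¹ with hK
  have hX := hXU.measurable_sample
  have hU := hXU.measurable_aux
  have key : ∀ (p : IndexPartition n) (D : Set ({c // c ∈ p.parts} → 𝕏)), MeasurableSet D →
      ∀ C : Set ℝ, MeasurableSet C →
      P' ({ω | tiePartition (X ω) = p ∧ cellValues p (X ω) ∈ D} ∩ U ⁻¹' C) =
        K * ∫⁻ u in Set.Ioi (0 : ℝ) ∩ C, uWeight η ρ γ q n u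
            (∫⁻ y in D, tauProd ρ p y (γ + u) ∂(Measure.pi fun _ => η)) := by
    intro p D hD C hC
    have hQ := measure_tiePartition_cellValues_of_rectangle (η := η) (ρ := ρ)
      (Q := (P'.restrict (U ⁻¹' C)).map X) γ q C K (fun B hB => by
        rw [Measure.map_apply hX (MeasurableSet.univ_pi hB),
          Measure.restrict_apply (hX (MeasurableSet.univ_pi hB)), hK, mul_assoc,
          ← hXU.measure_rectangle hρ hν_fin hν_inf hN hγ hq hn hμt hB hC]
        congr 1
        ext ω
        simp) p hD
    have hE := measurableSet_tiePartition_cellValues p hD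
    rw [Measure.map_apply hX hE, Measure.restrict_apply (hX hE),
      setLIntegral_lintegral_uWeight_swap] at hQ
    exact hQ
  -- The events that the ties equal `p` exhaust the space. This identifies `K` without computing it,
  -- and rules out an infinite sum since `K * ∞` is never `1`.
  have hsum : K * ∑ p' : IndexPartition n, kappaIntegral η ρ γ q p' = 1 := by
    rw [Finset.mul_sum, ← measure_univ (μ := P'),
      ← sum_measure_tiePartition (P' := P') hX MeasurableSet.univ]
    refine Finset.sum_congr rfl fun p _ => ?_
    have := key p Set.univ MeasurableSet.univ Set.univ MeasurableSet.univ
    rw [setLIntegral_tauProd_univ] at this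
    simpa using this.symm
  have hKZ : K = (∑ p' : IndexPartition n, kappaIntegral η ρ γ q p')⁻¹ :=
    ENNReal.eq_inv_of_mul_eq_one_left hsum
  refine ⟨fun h => ?_, hKZ ▸ key⟩
  rw [hKZ, h] at hsum
  simp at hsum

end Main
end TiltedCRM

/-! ### Marginal and conditional laws -/

open TiltedCRM in
theorem proposition3p2
    {𝕏 : Type*} [TopologicalSpace 𝕏] [PolishSpace 𝕏] [MeasurableSpace 𝕏] [BorelSpace 𝕏]
    -- the parameter measure `ν(dx, ds) = η(dx) ρ_x(ds)`
    (η : Measure 𝕏) [IsProbabilityMeasure η] [NullSingletonClass η]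
    (ρ : Kernel 𝕏 ℝ) [IsSFiniteKernel ρ] (hρ : ∀ x, ρ x (Set.Iic 0) = 0)
    (hν_fin : ∀ s : ℝ, 0 < s → ∫⁻ z, ENNReal.ofReal (min z.2 s) ∂(intensity η ρ) < ∞)
    (hν_inf : intensity η ρ Set.univ = ∞)
    -- the Poisson process
    {Ω : Type*} [MeasurableSpace Ω] (P : Measure Ω) [IsProbabilityMeasure P]
    (N : Ω → Measure (𝕏 × ℝ)) (hN : IsPoissonProcess P N (intensity η ρ))
    -- the tilting parameters
    (γ q : ℝ) (hγ : 0 ≤ γ) (hq : 0 ≤ q)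
    (hh : ∫⁻ ω, ENNReal.ofReal
      (polyExpTilt γ q (jumpMeasure (N ω) Set.univ).toReal) ∂P < ∞)
    -- the tilted completely random measure, the sample and the auxiliary variable
    (n : ℕ) (hn : 1 ≤ n)
    {Ω' : Type*} [MeasurableSpace Ω'] (P' : Measure Ω') [IsProbabilityMeasure P']
    (μt : Ω' → Measure 𝕏) (X : Ω' → Fin n → 𝕏) (U : Ω' → ℝ)
    (hμt : P'.map μt = tiltedLaw (polyExpTilt γ q) (P.map (fun ω => jumpMeasure (N ω))))
    (hXU : IsAugmentedSample P' q μt X U) :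
    -- all denominators below are positive and finite
    ((∀ p : IndexPartition n,
        0 < kappaIntegral η ρ γ q p ∧ kappaIntegral η ρ γ q p < ∞) ∧
      (∀ (u : ℝ) (p : IndexPartition n), 0 < u →
        0 < kappaProd η ρ p (γ + u) ∧ kappaProd η ρ p (γ + u) < ∞)) ∧
    -- 1. the law of the distinct values and the partition
    (∀ (p : IndexPartition n) (D : Set ({c // c ∈ p.parts} → 𝕏)), MeasurableSet D →
      P' {ω | tiePartition (X ω) = p ∧ cellValues p (X ω) ∈ D} =
        ∫⁻ y in D, tauIntegral η ρ γ q p y /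
          (∑ p' : IndexPartition n, kappaIntegral η ρ γ q p') ∂(Measure.pi fun _ => η)) ∧
    -- 2. the law of the partition
    (∀ p : IndexPartition n,
      P' {ω | tiePartition (X ω) = p} =
        kappaIntegral η ρ γ q p / ∑ p' : IndexPartition n, kappaIntegral η ρ γ q p') ∧
    -- 3. the law of the distinct values and the partition, given `U`
    (∀ (p : IndexPartition n) (D : Set ({c // c ∈ p.parts} → 𝕏)), MeasurableSet D →
      P'⟦{ω | tiePartition (X ω) = p ∧ cellValues p (X ω) ∈ D} |
          MeasurableSpace.comap U inferInstance⟧ =ᵐ[P']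
        fun ω => (∫⁻ y in D, tauProd ρ p y (γ + U ω) /
          (∑ p' : IndexPartition n, kappaProd η ρ p' (γ + U ω))
            ∂(Measure.pi fun _ => η)).toReal) ∧
    -- 4. the law of the partition, given `U`
    (∀ p : IndexPartition n,
      P'⟦{ω | tiePartition (X ω) = p} | MeasurableSpace.comap U inferInstance⟧ =ᵐ[P']
        fun ω => (kappaProd η ρ p (γ + U ω) /
          ∑ p' : IndexPartition n, kappaProd η ρ p' (γ + U ω)).toReal) ∧
    -- 5. the law of `U`, given the partition
    (∀ p : IndexPartition n,
      (P'[|{ω | tiePartition (X ω) = p}]).map U =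
        (volume.restrict (Set.Ioi (0 : ℝ))).withDensity
          (fun u => uWeight η ρ γ q n u (kappaProd η ρ p (γ + u)) /
            kappaIntegral η ρ γ q p)) := by

  have hν0 : intensity η ρ ≠ 0 := fun h => by simp [h] at hν_inf
  have hX := hXU.measurable_sample
  have hU := hXU.measurable_aux
  obtain ⟨hZtop, hjoint⟩ :=
    hXU.measure_tiePartition_cellValues hρ hν_fin hν_inf hN hγ hq hn hμt
  have hIpos : ∀ p : IndexPartition n, 0 < kappaIntegral η ρ γ q p :=
    fun p => kappaIntegral_pos hρ hν0 hγ q p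
  have hItop : ∀ p : IndexPartition n, kappaIntegral η ρ γ q p < ∞ := fun p =>
    (Finset.single_le_sum (fun _ _ => zero_le) (Finset.mem_univ p)).trans_lt hZtop.lt_top
  have hκpos : ∀ (u : ℝ) (p : IndexPartition n), 0 < u → 0 < kappaProd η ρ p (γ + u) :=
    fun u p hu => kappaProd_pos hρ hν0 p (add_nonneg hγ hu.le)
  have hκtop : ∀ (u : ℝ) (p : IndexPartition n), 0 < u → kappaProd η ρ p (γ + u) < ∞ :=
    fun u p hu => kappaProd_lt_top hρ hν_fin p (add_pos_of_nonneg_of_pos hγ hu)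
  set Z := ∑ p' : IndexPartition n, kappaIntegral η ρ γ q p' with hZ
  -- Any partition would do here; `⊤` is merely available.
  have hZ0 : Z ≠ 0 :=
    ((hIpos ⊤).trans_le (Finset.single_le_sum (fun _ _ => zero_le) (Finset.mem_univ _))).ne'
  let S : ℝ → ℝ≥0∞ := fun u => ∑ p' : IndexPartition n, kappaProd η ρ p' (γ + u)
  have hSm : Measurable S := Finset.measurable_fun_sum _ fun p _ =>
    (measurable_kappaProd p).comp (measurable_id.const_add γ)
  have hS0 : ∀ u, 0 < u → S u ≠ 0 := fun u hu => ((hκpos u ⊤ hu).trans_le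
    (Finset.single_le_sum (f := fun p' => kappaProd η ρ p' (γ + u)) (fun _ _ => zero_le)
      (Finset.mem_univ _))).ne'
  have hStop : ∀ u, 0 < u → S u ≠ ∞ := fun u hu =>
    ENNReal.sum_ne_top.2 fun p _ => (hκtop u p hu).ne
  have htie : ∀ p : IndexPartition n, {ω | tiePartition (X ω) = p} =
      {ω | tiePartition (X ω) = p ∧ cellValues p (X ω) ∈ Set.univ} := fun p => by simp
  have hpart : ∀ (p : IndexPartition n) (C : Set ℝ), MeasurableSet C →
      P' ({ω | tiePartition (X ω) = p} ∩ U ⁻¹' C) = Z⁻¹ *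
        ∫⁻ u in Set.Ioi (0 : ℝ) ∩ C, uWeight η ρ γ q n u (kappaProd η ρ p (γ + u)) := by
    intro p C hC
    rw [htie, hjoint p Set.univ MeasurableSet.univ C hC]
    simp_rw [Measure.restrict_univ, lintegral_tauProd]
  have hprob : ∀ p : IndexPartition n,
      P' {ω | tiePartition (X ω) = p} = Z⁻¹ * kappaIntegral η ρ γ q p := by
    intro p
    have := hpart p Set.univ MeasurableSet.univ
    simpa [kappaIntegral] using this
  -- Summing the joint law over all partitions gives the density of `U`, with `S` in place of a
  -- single product.
  have hUlaw : P'.map U =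
      Z⁻¹ • (volume.restrict (Set.Ioi (0 : ℝ))).withDensity fun u => uWeight η ρ γ q n u (S u) := by
    ext C hC
    rw [Measure.map_apply hU hC, ← sum_measure_tiePartition (P' := P') hX (hU hC),
      Measure.smul_apply, withDensity_apply _ hC, Measure.restrict_restrict hC, Set.inter_comm C,
      smul_eq_mul]
    simp_rw [S, uWeight_sum]
    rw [lintegral_finsetSum _ fun p _ => measurable_uWeight_kappaProd γ q p, Finset.mul_sum]
    exact Finset.sum_congr rfl fun p _ => hpart p C hC
  have htauD : ∀ (p : IndexPartition n) (D : Set ({c // c ∈ p.parts} → 𝕏)),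
      Measurable fun u : ℝ => ∫⁻ y in D, tauProd ρ p y (γ + u) ∂(Measure.pi fun _ => η) :=
    fun p D => Measurable.lintegral_prod_left'
      (f := fun z : ({c // c ∈ p.parts} → 𝕏) × ℝ => tauProd ρ p z.1 (γ + z.2))
      ((measurable_tauProd p).comp (measurable_fst.prodMk (measurable_snd.const_add γ)))
  have htau : ∀ (p : IndexPartition n) (a : ℝ),
      Measurable fun y : {c // c ∈ p.parts} → 𝕏 => tauProd ρ p y a := fun p a =>
    (measurable_tauProd p).comp measurable_prodMk_right
  have hcond : ∀ (p : IndexPartition n) (D : Set ({c // c ∈ p.parts} → 𝕏)), MeasurableSet D →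
      P'⟦{ω | tiePartition (X ω) = p ∧ cellValues p (X ω) ∈ D} |
          MeasurableSpace.comap U inferInstance⟧ =ᵐ[P']
        fun ω => (∫⁻ y in D, tauProd ρ p y (γ + U ω) /
          (∑ p' : IndexPartition n, kappaProd η ρ p' (γ + U ω))
            ∂(Measure.pi fun _ => η)).toReal := by
    intro p D hD
    have hdiv : ∀ u : ℝ, ∫⁻ y in D, tauProd ρ p y (γ + u) / S u ∂(Measure.pi fun _ => η) =
        (∫⁻ y in D, tauProd ρ p y (γ + u) ∂(Measure.pi fun _ => η)) / S u := fun u => by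
      simp_rw [div_eq_mul_inv]
      exact lintegral_mul_const _ (htau p _)
    have hGm : Measurable fun u : ℝ =>
        ∫⁻ y in D, tauProd ρ p y (γ + u) / S u ∂(Measure.pi fun _ => η) := by
      simp_rw [hdiv]
      exact (htauD p D).div hSm
    have hwS : Measurable fun u : ℝ => uWeight η ρ γ q n u (S u) :=
      measurable_uWeight γ q n measurable_id hSm
    refine condExp_indicator_comap_ae_eq hU
      (hX (measurableSet_tiePartition_cellValues p hD)) hGm fun C hC => ?_
    refine Eq.trans ?_ (hjoint p D hD C hC).symm
    -- Bayes' rule: integrating against the law of `U` multiplies by its density, where `S u`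
    -- cancels the denominator. This is legitimate because only `u > 0` is charged, where `S u` is
    -- neither `0` nor `∞`.
    rw [← setLIntegral_map hC hGm hU, hUlaw, Measure.restrict_smul,
      lintegral_smul_measure, smul_eq_mul, restrict_withDensity hC,
      Measure.restrict_restrict hC, Set.inter_comm C,
      lintegral_withDensity_eq_lintegral_mul _ hwS hGm]
    congr 1
    refine setLIntegral_congr_fun (measurableSet_Ioi.inter hC) fun u hu => ?_
    simp only [Pi.mul_apply, hdiv]
    unfold uWeight
    rw [mul_right_comm, mul_assoc _ (S u), ENNReal.mul_div_cancel (hS0 u hu.1) (hStop u hu.1)]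
  refine ⟨⟨fun p => ⟨hIpos p, hItop p⟩, fun u p hu => ⟨hκpos u p hu, hκtop u p hu⟩⟩,
    fun p D hD => ?_, fun p => ?_, hcond, fun p => ?_, fun p => ?_⟩
  · have h := hjoint p D hD Set.univ MeasurableSet.univ
    rw [Set.preimage_univ, Set.inter_univ, Set.inter_univ,
      ← setLIntegral_lintegral_uWeight_swap] at h
    simp_rw [h, div_eq_mul_inv]
    rw [mul_comm, ← lintegral_mul_const' _ _ (ENNReal.inv_ne_top.2 hZ0)]
    rfl
  · rw [hprob, mul_comm, div_eq_mul_inv]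
  · rw [htie]
    filter_upwards [hcond p Set.univ MeasurableSet.univ] with ω hω
    rw [hω]
    simp_rw [Measure.restrict_univ, div_eq_mul_inv]
    rw [lintegral_mul_const _ (htau p _), lintegral_tauProd]
  · ext C hC
    have hE : MeasurableSet {ω | tiePartition (X ω) = p} := hX (measurableSet_tiePartition_eq p)
    -- The joint law divided by the probability of `p`; the factor `Z⁻¹` occurs in both and cancels.
    rw [Measure.map_apply hU hC, cond_apply hE, hprob, hpart p C hC, withDensity_apply _ hC,
      Measure.restrict_restrict hC, Set.inter_comm C,
      ENNReal.mul_inv (Or.inr (hItop p).ne) (Or.inr (hIpos p).ne'), inv_inv]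
    simp_rw [div_eq_mul_inv]
    rw [lintegral_mul_const _ (measurable_uWeight_kappaProd γ q p), mul_mul_mul_comm,
      ENNReal.mul_inv_cancel hZ0 hZtop, one_mul, mul_comm]
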